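/- Let $(X_t)_{t\ge 0}$ be a (strictly) stationary AR(1) process, $X_t=\theta X_{t-1}+Z_t$ for $t=1,2,\dots$, where $|\theta|<1$ and the errors $Z_1,Z_2,\dots$ are i.i.d. with $E Z_t=0$, $\operatorname{Var} Z_t=\sigma^2>0$ and $E Z_t^4<\infty$. Let $\{w_{nt}: 1\le t\le n,\ n\ge 1\}$ be a triangular array of square integrable random variables (bootstrap weights), defined on the same probability space, independent of $(X_t)$ and row-exchangeable, i.e. for each $n$ the law of $(w_{n1},\dots,w_{nn})$ is invariant under permutations of the coordinates. Write $\sigma_n^2=\operatorname{Var}(w_{n1})$ and $W_{nt}=\sigma_n^{-1}(w_{nt}-1)$, and assume: (A1) $E w_{n1}=1$ for all $n\ge 1$; (A2) there is a constant $k>0$ with $\sigma_n^2>k$ for all large $n$, and $\sigma_n^2=o(n)$; (A3) $\operatorname{Cov}(w_{n1},w_{n2})=O(n^{-1})$; (A4) the array $U_{nj}=W_{nj}$ satisfies, for all large $n$, $E U_{nj}=0$ and $E U_{nj}^2=1$ for $1\le j\le n$, and moreover $\frac1n\sum_{j=1}^n U_{nj}^2\to 1$ in probability as $n\to\infty$ and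 $\lim_{K\to\infty}\limsup_{n\to\infty}\sqrt{E\big(U_{n1}^2\,\mathbf 1_{\{|U_{n1}|>K\}}\big)}=0$. Let $$\hat\theta_n=\frac{\sum_{t=2}^n X_tX_{t-1}}{\sum_{t=2}^n X_{t-1}^2},\qquad \hat\theta_n^*=\frac{\sum_{t=2}^n w_{nt}X_tX_{t-1}}{\sum_{t=2}^n w_{nt}X_{t-1}^2}$$ be the least-squares estimator and the weighted bootstrap least-squares estimator. Then for every $x\in\mathbb R$, as $n\to\infty$, $$P\big[\sqrt n\,\sigma_n^{-1}(\hat\theta_n^*-\hat\theta_n)\le x\,\big|\,X_1,\dots,X_n\big]-P[Y\le x]\longrightarrow 0\quad\text{in probability},$$ where $Y\sim N(0,1-\theta^2)$. -/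

import Mathlib

open MeasureTheory ProbabilityTheory Filter Topology Asymptotics
open scoped ENNReal

namespace WeightedBootstrap

variable {Ω : Type*} [MeasurableSpace Ω]

/-- `X` is a (strictly) stationary AR(1) process with parameter `θ`, `|θ| < 1`, driven by the
errors `Z 1, Z 2, …`, which are i.i.d. with mean `0`, variance `σ² > 0` and finite fourth moment.
(`Z 0` plays no role.) -/
structure IsStationaryAR1 (P : Measure Ω) (X Z : ℕ → Ω → ℝ) (θ σ : ℝ) : Prop where
  measurable_X : ∀ t, Measurable (X t)
  measurable_Z : ∀ t, Measurable (Z t)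
  recursion : ∀ t, 1 ≤ t → ∀ᵐ ω ∂P, X t ω = θ * X (t - 1) ω + Z t ω
  stationary : ∀ k, IdentDistrib (fun ω (t : ℕ) => X (t + k) ω) (fun ω (t : ℕ) => X t ω) P P
  indep : iIndepFun (fun t : ℕ => Z (t + 1)) P
  identDistrib : ∀ t, 1 ≤ t → IdentDistrib (Z t) (Z 1) P P
  fourth_moment : MemLp (Z 1) 4 P
  mean_zero : ∫ ω, Z 1 ω ∂P = 0
  variance_eq : Var[Z 1; P] = σ ^ 2
  sigma_pos : 0 < σ
  abs_theta_lt_one : |θ| < 1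

/-- The least squares estimator based on `X 1, …, X n`. -/
noncomputable def lse (X : ℕ → Ω → ℝ) (n : ℕ) (ω : Ω) : ℝ :=
  (∑ t ∈ Finset.Icc 2 n, X t ω * X (t - 1) ω) / ∑ t ∈ Finset.Icc 2 n, (X (t - 1) ω) ^ 2

/-- The weighted bootstrap least squares estimator with weights `w n 1, …, w n n`. -/
noncomputable def bootLse (X : ℕ → Ω → ℝ) (w : ℕ → ℕ → Ω → ℝ) (n : ℕ) (ω : Ω) : ℝ :=
  (∑ t ∈ Finset.Icc 2 n, w n t ω * X t ω * X (t - 1) ω) /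
    ∑ t ∈ Finset.Icc 2 n, w n t ω * (X (t - 1) ω) ^ 2

/-- The `n`-th row `(w n 1, …, w n n)` of a triangular array, as a random vector. -/
def row (w : ℕ → ℕ → Ω → ℝ) (n : ℕ) (ω : Ω) (i : Fin n) : ℝ := w n (i + 1) ω

/-- Row exchangeability: the law of every row is invariant under permutations of its entries. -/
def RowExchangeable (P : Measure Ω) (w : ℕ → ℕ → Ω → ℝ) : Prop :=
  ∀ (n : ℕ) (π : Equiv.Perm (Fin n)),
    IdentDistrib (fun ω (i : Fin n) => row w n ω (π i)) (row w n) P P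

/-- The common standard deviation `σ_n` of the weights in the `n`-th row. -/
noncomputable def weightSd (P : Measure Ω) (w : ℕ → ℕ → Ω → ℝ) (n : ℕ) : ℝ :=
  √(Var[w n 1; P])

/-- The standardized weights `W n t = (w n t - 1) / σ_n`. -/
noncomputable def stdWeight (P : Measure Ω) (w : ℕ → ℕ → Ω → ℝ) (n t : ℕ) (ω : Ω) : ℝ :=
  (weightSd P w n)⁻¹ * (w n t ω - 1)

/-- The conditions of Præstgaard and Wellner on a row exchangeable triangular array `U n j`,
`1 ≤ j ≤ n`. In the last one `j = 1` stands for any index, the rows being exchangeable. -/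
structure PWConditions (P : Measure Ω) (U : ℕ → ℕ → Ω → ℝ) : Prop where
  mean_zero : ∀ᶠ n in atTop, ∀ j ∈ Finset.Icc 1 n, ∫ ω, U n j ω ∂P = 0
  second_moment : ∀ᶠ n in atTop, ∀ j ∈ Finset.Icc 1 n, ∫ ω, (U n j ω) ^ 2 ∂P = 1
  mean_sq : TendstoInMeasure P
    (fun (n : ℕ) ω => (1 / (n : ℝ)) * ∑ j ∈ Finset.Icc 1 n, (U n j ω) ^ 2) atTop (fun _ => 1)
  tail : Tendsto
    (fun k : ℝ => limsup
      (fun n : ℕ => (∫⁻ ω in {ω | k < |U n 1 ω|}, ENNReal.ofReal ((U n 1 ω) ^ 2) ∂P) ^ (1 / 2 : ℝ))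
      atTop)
    atTop (𝓝 0)

/-- The bootstrap weights `w n t`, `1 ≤ t ≤ n`: square integrable, independent of the process `X`
(row by row), row exchangeable, with mean `1`, variance `σ_n²` eventually bounded away from `0` and
`o(n)`, covariance `O(1/n)`, and such that the standardized weights satisfy the
Præstgaard–Wellner conditions. -/
structure IsBootstrapWeights (P : Measure Ω) (X : ℕ → Ω → ℝ) (w : ℕ → ℕ → Ω → ℝ) : Prop where
  measurable_w : ∀ n, ∀ t ∈ Finset.Icc 1 n, Measurable (w n t)
  memLp_two : ∀ n, ∀ t ∈ Finset.Icc 1 n, MemLp (w n t) 2 P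
  indep_data : ∀ n, IndepFun (row w n) (fun ω (t : ℕ) => X t ω) P
  exchangeable : RowExchangeable P w
  mean_one : ∀ n, 1 ≤ n → ∫ ω, w n 1 ω ∂P = 1
  variance_lower : ∃ k : ℝ, 0 < k ∧ ∀ᶠ n in atTop, k < weightSd P w n ^ 2
  variance_upper : (fun n => weightSd P w n ^ 2) =o[atTop] (fun n : ℕ => (n : ℝ))
  covariance : (fun n => cov[w n 1, w n 2; P]) =O[atTop] (fun n : ℕ => (n : ℝ)⁻¹)
  pw : PWConditions P (stdWeight P w)

/-- The σ-algebra generated by the data `X 1, …, X n`. -/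
@[reducible] def dataSigma (X : ℕ → Ω → ℝ) (n : ℕ) : MeasurableSpace Ω :=
  ⨆ t ∈ Finset.Icc 1 n, MeasurableSpace.comap (X t) inferInstance

end WeightedBootstrap

/-!
Since the weights are independent of the data, the conditional distribution of the bootstrap error
given `X 1, …, X n` is its distribution for frozen data (`IsBootstrapWeights.condProb_ae_eq`). By
the subsequence criterion for convergence in probability it suffices to treat, along a subsequence,
a fixed data sequence whose empirical moments converge.

For fixed data, the least squares scores `(X t - θ̂ X (t - 1)) X (t - 1)` sum to zero, so the bootstrap
error is a linear combination of the exchangeable standardized weights `W n t`, divided by the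
weighted mean of the `X (t - 1) ^ 2` (`bootStat_eq_sum_score_div`). The denominator is consistent by
a second moment computation, since the weights are almost uncorrelated and `σ_n ^ 2 = o(n)`
(`IsBootstrapWeights.tendstoInMeasure_denominator`). The numerator obeys a central limit theorem
(`tendsto_charFun_of_exchangeable`): interchanging two randomly chosen weights yields an
exchangeable pair whose drift is linear because the coefficients sum to zero
(`Exchangeable.integral_sum_mul_eq`). Taken with `x ↦ exp (i s x)`, Stein's identity says that the
characteristic function `φ` of the numerator nearly solves `φ' = -t s φ`, where `t` is the limit of
the sums of the squared scores; the errors are bounded by truncating the weights, whose squares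
are uniformly integrable.

For the data, stationarity and `θ ^ k → 0` show that the process is the weak limit of recursions
started at zero. Hence the innovation `Z (t + 1)` is independent of `X 0, …, X t`
(`IsStationaryAR1.indepFun_past`), although this is not part of the assumptions, and `X 0` has a
finite fourth moment (`IsStationaryAR1.memLp_X_zero`). Sums of `G (X t) H (Z (t + 1))` with centered
`H (Z 1)` then have uncorrelated summands, which gives convergence in mean of the empirical moments
(`IsStationaryAR1.tendsto_integral_dataError`), without an ergodic theorem. The second moment
`σ ^ 2 / (1 - θ ^ 2)` of the data results from squaring the recursion and summing
(`sum_lag_sq_eq`), and the squared scores sum up to `σ ^ 2` times it in the limit; the quotient of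
this and of the squared second moment is the limiting variance `1 - θ ^ 2`.
-/

namespace WeightedBootstrap

/-! ### Moments of exchangeable families -/

section Exchangeable

variable {Ω : Type*} [MeasurableSpace Ω] {P : Measure Ω}

theorem integral_abs_mul_le_sqrt {U V : Ω → ℝ} (hU : MemLp U 2 P) (hV : MemLp V 2 P) :
    ∫ ω, |U ω * V ω| ∂P ≤ √(∫ ω, U ω ^ 2 ∂P) * √(∫ ω, V ω ^ 2 ∂P) := by
  have h := integral_mul_le_Lp_mul_Lq_of_nonneg (μ := P) (p := 2) (q := 2)
    (by constructor <;> norm_num) (f := fun ω => |U ω|) (g := fun ω => |V ω|)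
    (Eventually.of_forall fun _ => abs_nonneg _) (Eventually.of_forall fun _ => abs_nonneg _)
    (by simpa using! hU.abs) (by simpa using! hV.abs)
  simpa [abs_mul, Real.sqrt_eq_rpow] using h

theorem integral_abs_le_sqrt [IsProbabilityMeasure P] {U : Ω → ℝ} (hU : MemLp U 2 P) :
    ∫ ω, |U ω| ∂P ≤ √(∫ ω, U ω ^ 2 ∂P) := by
  simpa using integral_abs_mul_le_sqrt hU (memLp_const (1 : ℝ))

theorem integrable_mul_of_memLp_two {U V : Ω → ℝ} (hU : MemLp U 2 P) (hV : MemLp V 2 P) :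
    Integrable (fun ω => U ω * V ω) P := hU.integrable_mul hV

variable {ι : Type*}

/-- A finite family of real random variables is exchangeable if its joint law is invariant under
permutations of the index set. -/
def Exchangeable (P : Measure Ω) (W : ι → Ω → ℝ) : Prop :=
  ∀ π : Equiv.Perm ι, IdentDistrib (fun ω i => W (π i) ω) (fun ω i => W i ω) P P

theorem Exchangeable.integral_perm {E : Type*} [NormedAddCommGroup E] [NormedSpace ℝ E]
    [MeasurableSpace E] [BorelSpace E] {W : ι → Ω → ℝ} (hW : Exchangeable P W)
    (π : Equiv.Perm ι) {g : (ι → ℝ) → E} (hg : Measurable g) :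
    ∫ ω, g (fun i => W (π i) ω) ∂P = ∫ ω, g (fun i => W i ω) ∂P :=
  ((hW π).comp hg).integral_eq

theorem Exchangeable.identDistrib [DecidableEq ι] {W : ι → Ω → ℝ} (hW : Exchangeable P W)
    (i j : ι) : IdentDistrib (W i) (W j) P P := by
  have h := (hW (Equiv.swap i j)).comp (measurable_pi_apply j)
  simpa [Function.comp_def] using h

theorem Exchangeable.identDistrib_pair [DecidableEq ι] {W : ι → Ω → ℝ} (hW : Exchangeable P W)
    {i j k l : ι} (hij : i ≠ j) (hkl : k ≠ l) :
    IdentDistrib (fun ω => (W i ω, W j ω)) (fun ω => (W k ω, W l ω)) P P := by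
  set π : Equiv.Perm ι := Equiv.swap (Equiv.swap k i l) j * Equiv.swap k i with hπ
  have hk : π k = i := by
    have h1 : i ≠ Equiv.swap k i l := by
      intro h
      apply hkl
      have := congrArg (Equiv.swap k i) h
      simpa using this
    simp [hπ, Equiv.swap_apply_of_ne_of_ne h1 hij]
  have hl : π l = j := by simp [hπ]
  have h := (hW π).comp ((measurable_pi_apply k).prodMk (measurable_pi_apply l))
  simpa [Function.comp_def, hk, hl] using h

variable [Fintype ι]

/-- The second moment of a linear combination of variables with common second moment `v` and
common mixed moment `c`. -/
theorem integral_sum_mul_sq [DecidableEq ι] {Y : ι → Ω → ℝ} (hY : ∀ i, MemLp (Y i) 2 P) {v c : ℝ}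
    (hv : ∀ i, ∫ ω, Y i ω ^ 2 ∂P = v) (hc : ∀ i j, i ≠ j → ∫ ω, Y i ω * Y j ω ∂P = c)
    (α : ι → ℝ) :
    ∫ ω, (∑ i, α i * Y i ω) ^ 2 ∂P = (v - c) * ∑ i, α i ^ 2 + c * (∑ i, α i) ^ 2 := by
  have h1 : ∀ ω, (∑ i, α i * Y i ω) ^ 2 = ∑ i, ∑ j, (α i * α j) * (Y i ω * Y j ω) := by
    intro ω
    rw [sq, Finset.sum_mul_sum]
    exact Finset.sum_congr rfl fun i _ => Finset.sum_congr rfl fun j _ => by ring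
  have hint : ∀ i j, Integrable (fun ω => (α i * α j) * (Y i ω * Y j ω)) P := fun i j =>
    (integrable_mul_of_memLp_two (hY i) (hY j)).const_mul _
  have h2 : ∀ i j, ∫ ω, (α i * α j) * (Y i ω * Y j ω) ∂P
      = (if i = j then (v - c) * (α i * α j) else 0) + c * (α i * α j) := by
    intro i j
    rw [integral_const_mul]
    split_ifs with h
    · subst h
      have := hv i
      simp only [sq] at this
      rw [this]; ring
    · rw [hc i j h]; ring
  simp_rw [h1]
  rw [integral_finsetSum _ fun i _ => integrable_finsetSum _ fun j _ => hint i j]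
  simp_rw [integral_finsetSum _ fun j _ => hint _ j, h2, Finset.sum_add_distrib]
  congr 1
  · simp [Finset.mul_sum, sq]
  · rw [sq, Finset.sum_mul_sum]
    simp_rw [Finset.mul_sum]

theorem abs_mixed_moment_le {U V : Ω → ℝ} (hU : MemLp U 2 P) (hV : MemLp V 2 P) {v : ℝ}
    (hv : ∫ ω, U ω ^ 2 ∂P = v) (hv' : ∫ ω, V ω ^ 2 ∂P = v) : |∫ ω, U ω * V ω ∂P| ≤ v := by
  have h0 : 0 ≤ v := hv ▸ integral_nonneg fun _ => sq_nonneg _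
  calc |∫ ω, U ω * V ω ∂P| ≤ ∫ ω, |U ω * V ω| ∂P := abs_integral_le_integral_abs
    _ ≤ √v * √v := by simpa [hv, hv'] using integral_abs_mul_le_sqrt hU hV
    _ = v := Real.mul_self_sqrt h0

/-- A linear combination with coefficients of sum zero of functions of exchangeable variables has
second moment of the same order as in the independent case. -/
theorem Exchangeable.integral_comp_sq_sum_le [DecidableEq ι] {W : ι → Ω → ℝ}
    (hW : Exchangeable P W) {g : ℝ → ℝ} (hg : Measurable g)
    (hY : ∀ i, MemLp (fun ω => g (W i ω)) 2 P) {v : ℝ}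
    (hv : ∀ i, ∫ ω, g (W i ω) ^ 2 ∂P = v) {α : ι → ℝ} (hα : ∑ i, α i = 0) :
    ∫ ω, (∑ i, α i * g (W i ω)) ^ 2 ∂P ≤ 2 * v * ∑ i, α i ^ 2 := by
  by_cases hne : ∃ i j : ι, i ≠ j
  · obtain ⟨k, l, hkl⟩ := hne
    have hc : ∀ i j, i ≠ j →
        ∫ ω, g (W i ω) * g (W j ω) ∂P = ∫ ω, g (W k ω) * g (W l ω) ∂P := fun i j hij =>
      ((hW.identDistrib_pair hij hkl).comp
        (u := fun p : ℝ × ℝ => g p.1 * g p.2) (by fun_prop)).integral_eq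
    rw [integral_sum_mul_sq hY hv hc, hα]
    have := abs_le.1 (abs_mixed_moment_le (hY k) (hY l) (hv k) (hv l))
    nlinarith [Finset.sum_nonneg fun i (_ : i ∈ Finset.univ) => sq_nonneg (α i)]
  · push Not at hne
    have hz : ∀ i, α i = 0 := by
      intro i
      rw [← hα]
      exact (Finset.sum_eq_single i (fun j _ h => absurd (hne j i) h) (by simp)).symm
    simp [hz]

end Exchangeable

/-! ### The exchangeable pair identity -/

section Stein

variable {Ω : Type*} [MeasurableSpace Ω] {P : Measure Ω} {ι : Type*}

/-- The increment of `∑ i, b i * w i` when the entries `w i` and `w j` are exchanged. -/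
def swapIncr (b w : ι → ℝ) (i j : ι) : ℝ := -((b i - b j) * (w i - w j))

@[fun_prop]
theorem measurable_swapIncr (b : ι → ℝ) (i j : ι) : Measurable fun w => swapIncr b w i j := by
  unfold swapIncr; fun_prop

theorem swapIncr_swap [DecidableEq ι] (b w : ι → ℝ) (i j : ι) :
    swapIncr b (fun k => w (Equiv.swap i j k)) i j = -swapIncr b w i j := by
  simp only [swapIncr, Equiv.swap_apply_left, Equiv.swap_apply_right]; ring

variable [Fintype ι]

theorem sum_swapIncr (b w : ι → ℝ) (hb : ∑ i, b i = 0) :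
    ∑ i, ∑ j, swapIncr b w i j = -(2 * Fintype.card ι * ∑ i, b i * w i) := by
  have h : ∀ i, ∑ j, swapIncr b w i j
      = -(Fintype.card ι * (b i * w i)) + b i * ∑ j, w j - ∑ j, b j * w j := by
    intro i
    have : ∀ j, swapIncr b w i j = -(b i * w i) + b i * w j + b j * w i - b j * w j := by
      intro j; simp only [swapIncr]; ring
    simp_rw [this, Finset.sum_sub_distrib, Finset.sum_add_distrib, ← Finset.mul_sum,
      ← Finset.sum_mul, hb]
    simp
  simp_rw [h, Finset.sum_sub_distrib, Finset.sum_add_distrib, ← Finset.sum_mul, hb,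
    Finset.sum_neg_distrib, ← Finset.mul_sum]
  simp
  ring

theorem sum_swapIncr_sq (b w : ι → ℝ) (hb : ∑ i, b i = 0) :
    ∑ i, ∑ j, swapIncr b w i j ^ 2
      = 2 * Fintype.card ι * ∑ i, b i ^ 2 * w i ^ 2 + 2 * (∑ i, b i ^ 2) * ∑ i, w i ^ 2
        - 4 * (∑ i, w i) * (∑ i, b i ^ 2 * w i) + 4 * (∑ i, b i * w i) ^ 2 := by
  have h : ∀ i, ∑ j, swapIncr b w i j ^ 2
      = Fintype.card ι * (b i ^ 2 * w i ^ 2) - 2 * (b i ^ 2 * w i) * (∑ j, w j)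
        + b i ^ 2 * ∑ j, w j ^ 2 + 4 * (b i * w i) * (∑ j, b j * w j)
        - 2 * b i * (∑ j, b j * w j ^ 2) + w i ^ 2 * (∑ j, b j ^ 2)
        - 2 * w i * (∑ j, b j ^ 2 * w j) + ∑ j, b j ^ 2 * w j ^ 2 := by
    intro i
    have : ∀ j, swapIncr b w i j ^ 2
      = b i ^ 2 * w i ^ 2 - 2 * (b i ^ 2 * w i) * w j
        + b i ^ 2 * w j ^ 2 + 4 * (b i * w i) * (b j * w j)
        - 2 * b i * (b j * w j ^ 2) + w i ^ 2 * b j ^ 2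
        - 2 * w i * (b j ^ 2 * w j) + b j ^ 2 * w j ^ 2 - 2 * b i * w i ^ 2 * b j := by
      intro j; simp only [swapIncr]; ring
    simp only [this, Finset.sum_sub_distrib, Finset.sum_add_distrib, ← Finset.mul_sum, hb]
    simp
    ring
  simp only [h, Finset.sum_sub_distrib, Finset.sum_add_distrib, ← Finset.mul_sum,
    ← Finset.sum_mul, hb]
  simp
  ring

variable [DecidableEq ι]

theorem sum_mul_swap (b w : ι → ℝ) (i j : ι) :
    ∑ k, b k * w (Equiv.swap i j k) = ∑ k, b k * w k + swapIncr b w i j := by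
  by_cases hij : i = j
  · subst hij; simp [swapIncr]
  have h : ∑ k, b k * (w (Equiv.swap i j k) - w k) = swapIncr b w i j := by
    rw [Finset.sum_eq_add_of_mem i j (Finset.mem_univ _) (Finset.mem_univ _) hij]
    · simp only [Equiv.swap_apply_left, Equiv.swap_apply_right, swapIncr]; ring
    · intro k _ hk
      simp [Equiv.swap_apply_of_ne_of_ne hk.1 hk.2]
  rw [← h, ← Finset.sum_add_distrib]
  exact Finset.sum_congr rfl fun k _ => by ring

/-- Exchangeability makes `(V, V + D)` an exchangeable pair, `V = ∑ i, b i * W i` and `D` the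
increment of `V` under the transposition of `i` and `j`; summed over `i` and `j` the drift of
the pair is linear in `V`. -/
theorem Exchangeable.integral_sum_mul_eq {W : ι → Ω → ℝ} (hW : Exchangeable P W)
    (hL : ∀ i, Integrable (W i) P) {b : ι → ℝ} (hb : ∑ i, b i = 0) {f : ℝ → ℂ}
    (hf : Measurable f) (hf1 : ∀ x, ‖f x‖ ≤ 1) :
    4 * Fintype.card ι * ∫ ω, ((∑ i, b i * W i ω : ℝ) : ℂ) * f (∑ i, b i * W i ω) ∂P
      = ∑ i, ∑ j, ∫ ω, (swapIncr b (fun k => W k ω) i j : ℂ) *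
          (f (∑ i, b i * W i ω + swapIncr b (fun k => W k ω) i j) - f (∑ i, b i * W i ω)) ∂P := by
  have hVint : Integrable (fun ω => ∑ i, b i * W i ω) P :=
    integrable_finsetSum _ fun i _ => (hL i).const_mul _
  have hVm : AEMeasurable (fun ω => ∑ i, b i * W i ω) P := hVint.aemeasurable
  have hDint : ∀ i j, Integrable (fun ω => swapIncr b (fun k => W k ω) i j) P := fun i j =>
    (((hL i).sub (hL j)).const_mul (b i - b j)).neg
  have hD1 : ∀ i j, Integrable (fun ω => (swapIncr b (fun k => W k ω) i j : ℂ) *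
      f (∑ i, b i * W i ω)) P := fun i j =>
    (hDint i j).ofReal.mul_bdd (c := 1) (hf.comp_aemeasurable hVm).aestronglyMeasurable
      (Eventually.of_forall fun _ => hf1 _)
  have hD2 : ∀ i j, Integrable (fun ω => (swapIncr b (fun k => W k ω) i j : ℂ) *
      f (∑ i, b i * W i ω + swapIncr b (fun k => W k ω) i j)) P := fun i j =>
    (hDint i j).ofReal.mul_bdd (c := 1)
      (hf.comp_aemeasurable (hVm.add (hDint i j).aemeasurable)).aestronglyMeasurable
      (Eventually.of_forall fun _ => hf1 _)
  have hanti : ∀ i j, ∫ ω, (swapIncr b (fun k => W k ω) i j : ℂ) *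
      f (∑ i, b i * W i ω + swapIncr b (fun k => W k ω) i j) ∂P
      = -∫ ω, (swapIncr b (fun k => W k ω) i j : ℂ) * f (∑ i, b i * W i ω) ∂P := by
    intro i j
    have h := hW.integral_perm (Equiv.swap i j)
      (g := fun w => (swapIncr b w i j : ℂ) * f (∑ i, b i * w i + swapIncr b w i j))
      (by fun_prop)
    rw [← h, ← integral_neg]
    refine integral_congr_ae (Eventually.of_forall fun ω => ?_)
    simp only
    rw [swapIncr_swap b (fun k => W k ω), sum_mul_swap b (fun k => W k ω)]
    simp
  have hsub : ∀ i j, ∫ ω, (swapIncr b (fun k => W k ω) i j : ℂ) *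
      (f (∑ i, b i * W i ω + swapIncr b (fun k => W k ω) i j) - f (∑ i, b i * W i ω)) ∂P
      = -2 * ∫ ω, (swapIncr b (fun k => W k ω) i j : ℂ) * f (∑ i, b i * W i ω) ∂P := by
    intro i j
    simp_rw [mul_sub]
    rw [integral_sub (hD2 i j) (hD1 i j), hanti]
    ring
  simp_rw [hsub, ← Finset.mul_sum, ← integral_finsetSum _ fun j _ => hD1 _ j]
  rw [← integral_finsetSum _ fun i _ => integrable_finsetSum _ fun j _ => hD1 i j]
  have hpt : ∀ ω, ∑ i, ∑ j, (swapIncr b (fun k => W k ω) i j : ℂ) * f (∑ i, b i * W i ω)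
      = -(2 * Fintype.card ι) * (((∑ i, b i * W i ω : ℝ) : ℂ) * f (∑ i, b i * W i ω)) := by
    intro ω
    simp_rw [← Finset.sum_mul]
    have := congrArg (fun x : ℝ => (x : ℂ)) (sum_swapIncr b (fun k => W k ω) hb)
    simp only [Complex.ofReal_sum] at this
    rw [this]
    push_cast
    ring
  simp_rw [hpt, integral_const_mul]
  ring

end Stein

/-! ### Distance of the characteristic function to the Gaussian one -/

section CharFun

theorem norm_exp_mul_I_sub_one_sub_le (x : ℝ) :
    ‖Complex.exp (x * Complex.I) - 1 - x * Complex.I‖ ≤ 2 * min |x| (x ^ 2) := by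
  have hn : ‖(x : ℂ) * Complex.I‖ = |x| := by simp
  rcases le_total |x| 1 with h | h
  · have h1 := Complex.norm_exp_sub_one_sub_id_le (x := x * Complex.I) (by rw [hn]; exact h)
    rw [hn, sq_abs] at h1
    have : x ^ 2 ≤ |x| := by rw [← sq_abs]; nlinarith [abs_nonneg x]
    rw [min_eq_right this]
    nlinarith [sq_nonneg x]
  · have : |x| ≤ x ^ 2 := by rw [← sq_abs]; nlinarith [abs_nonneg x]
    rw [min_eq_left this]
    have h1 : ‖Complex.exp (x * Complex.I) - 1‖ ≤ |x| := by
      simpa [mul_comm] using Real.norm_exp_I_mul_ofReal_sub_one_le (x := x)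
    calc _ ≤ ‖Complex.exp (x * Complex.I) - 1‖ + ‖(x : ℂ) * Complex.I‖ := norm_sub_le _ _
      _ ≤ 2 * |x| := by rw [hn]; linarith

variable {Ω : Type*} [MeasurableSpace Ω] {P : Measure Ω}

theorem hasDerivAt_integral_exp_mul_I [IsFiniteMeasure P] {V : Ω → ℝ} (hV : Integrable V P)
    (s : ℝ) :
    HasDerivAt (fun s : ℝ => ∫ ω, Complex.exp ((s * V ω : ℝ) * Complex.I) ∂P)
      (∫ ω, Complex.I * ((V ω : ℂ) * Complex.exp ((s * V ω : ℝ) * Complex.I)) ∂P) s := by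
  have hm : ∀ s : ℝ, AEStronglyMeasurable
      (fun ω => Complex.exp ((s * V ω : ℝ) * Complex.I)) P := fun s => by
    have : Measurable fun x : ℝ => Complex.exp ((s * x : ℝ) * Complex.I) := by fun_prop
    exact (this.comp_aemeasurable hV.aemeasurable).aestronglyMeasurable
  refine (hasDerivAt_integral_of_dominated_loc_of_deriv_le (s := Set.univ) (x₀ := s)
    (F' := fun s ω => Complex.I * ((V ω : ℂ) * Complex.exp ((s * V ω : ℝ) * Complex.I)))
    (bound := fun ω => |V ω|) univ_mem (Eventually.of_forall hm) ?_ ?_ ?_ hV.abs ?_).2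
  · exact Integrable.of_bound (hm s) 1 (Eventually.of_forall fun ω => by
      rw [Complex.norm_exp_ofReal_mul_I])
  · exact ((hV.ofReal (𝕜 := ℂ)).aestronglyMeasurable.mul (hm s)).const_mul _
  · refine Eventually.of_forall fun ω s _ => ?_
    simp only [norm_mul, Complex.norm_I, one_mul, Complex.norm_real, Complex.norm_exp_ofReal_mul_I,
      mul_one, Real.norm_eq_abs, le_refl]
  · refine Eventually.of_forall fun ω s _ => ?_
    have h1 : HasDerivAt (fun s : ℝ => ((s * V ω : ℝ) : ℂ) * Complex.I)
        (((1 * V ω : ℝ) : ℂ) * Complex.I) s :=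
      (((hasDerivAt_id s).mul_const (V ω)).ofReal_comp).mul_const _
    convert! h1.cexp using 1
    push_cast; ring

/-- A function `φ` with `φ 0 = 1` which nearly solves the differential equation `φ' = -t s φ` of
the Gaussian characteristic function is close to it. -/
theorem norm_sub_gaussian_le_of_deriv {φ φ' : ℝ → ℂ} {t C r : ℝ} (ht : 0 ≤ t)
    (h0 : φ 0 = 1) (hd : ∀ s, HasDerivAt φ (φ' s) s)
    (hC : ∀ s, |s| ≤ |r| → ‖φ' s + (s * t : ℝ) * φ s‖ ≤ C) :
    ‖φ r - (Real.exp (-(r ^ 2 * t / 2)) : ℝ)‖ ≤ C * |r| := by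
  have hC0 : 0 ≤ C := (norm_nonneg _).trans (hC 0 (by simp))
  have hg : ∀ s : ℝ, HasDerivAt (fun s : ℝ => φ s * (Real.exp (s ^ 2 * t / 2) : ℝ))
      ((φ' s + (s * t : ℝ) * φ s) * (Real.exp (s ^ 2 * t / 2) : ℝ)) s := by
    intro s
    have h1 : HasDerivAt (fun s : ℝ => Real.exp (s ^ 2 * t / 2))
        (Real.exp (s ^ 2 * t / 2) * (s * t)) s := by
      have h2 : HasDerivAt (fun s : ℝ => s ^ 2 * t / 2) (s * t) s := by
        have := ((hasDerivAt_pow 2 s).mul_const t).div_const 2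
        convert! this using 1
        simp; ring
      exact h2.exp
    convert! (hd s).mul h1.ofReal_comp using 1
    push_cast; ring
  have hmv := Convex.norm_image_sub_le_of_norm_hasDerivWithin_le
    (f := fun s : ℝ => φ s * (Real.exp (s ^ 2 * t / 2) : ℝ))
    (s := Set.Icc (-|r|) |r|) (C := C * Real.exp (r ^ 2 * t / 2)) (x := 0) (y := r)
    (fun s _ => (hg s).hasDerivWithinAt) (fun s hs => ?_) (convex_Icc _ _) (by simp)
    ⟨neg_abs_le r, le_abs_self r⟩
  · have e1 : φ r - (Real.exp (-(r ^ 2 * t / 2)) : ℝ)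
        = (φ r * (Real.exp (r ^ 2 * t / 2) : ℝ) - φ 0 * (Real.exp (0 ^ 2 * t / 2) : ℝ))
          * (Real.exp (-(r ^ 2 * t / 2)) : ℝ) := by
      rw [sub_mul, mul_assoc, ← Complex.ofReal_mul, ← Real.exp_add, h0]
      simp
    rw [e1, norm_mul, Complex.norm_real, Real.norm_of_nonneg (Real.exp_nonneg _)]
    calc _ ≤ (C * Real.exp (r ^ 2 * t / 2) * ‖r - 0‖) * Real.exp (-(r ^ 2 * t / 2)) := by
          gcongr
      _ = C * |r| * (Real.exp (r ^ 2 * t / 2) * Real.exp (-(r ^ 2 * t / 2))) := by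
          rw [sub_zero, Real.norm_eq_abs]; ring
      _ = C * |r| := by rw [← Real.exp_add]; simp
  · have hs' : |s| ≤ |r| := abs_le.2 hs
    rw [norm_mul, Complex.norm_real, Real.norm_of_nonneg (Real.exp_nonneg _)]
    have : s ^ 2 ≤ r ^ 2 := sq_le_sq.2 hs'
    gcongr
    exact hC s hs'

variable {ι : Type*} [Fintype ι] [DecidableEq ι]

/-- The conditional mean square increment of `V = ∑ i, b i * w i` under a random transposition,
normalized to approximate the variance of `V`. -/
noncomputable def swapVar (b w : ι → ℝ) : ℝ :=
  (4 * Fintype.card ι : ℝ)⁻¹ * ∑ i, ∑ j, swapIncr b w i j ^ 2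

/-- The characteristic function of a linear combination of exchangeable variables is close to a
Gaussian one when the mean square increment under a random transposition is nearly constant and the
increments are small. By the exchangeable pair identity applied to `x ↦ exp (i s x)`, expanded to
second order, it nearly solves the differential equation of the Gaussian one. -/
theorem Exchangeable.norm_charFun_sub_le [IsProbabilityMeasure P] [Nonempty ι] {W : ι → Ω → ℝ}
    (hW : Exchangeable P W) (hL : ∀ i, MemLp (W i) 2 P) {b : ι → ℝ} (hb : ∑ i, b i = 0)
    {t : ℝ} (ht : 0 ≤ t) (r : ℝ) :
    ‖∫ ω, Complex.exp ((r * ∑ i, b i * W i ω : ℝ) * Complex.I) ∂P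
        - (Real.exp (-(r ^ 2 * t / 2)) : ℝ)‖
      ≤ (|r| * ∫ ω, |swapVar b (fun k => W k ω) - t| ∂P
          + (2 * Fintype.card ι : ℝ)⁻¹ * ∑ i, ∑ j, ∫ ω, |swapIncr b (fun k => W k ω) i j| *
            min |r * swapIncr b (fun k => W k ω) i j|
              ((r * swapIncr b (fun k => W k ω) i j) ^ 2) ∂P) * |r| := by
  have hN : (Fintype.card ι : ℝ) ≠ 0 := by simp
  have hNC : (Fintype.card ι : ℂ) ≠ 0 := by simp
  have hL1 : ∀ i, Integrable (W i) P := fun i => (hL i).integrable one_le_two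
  have hVint : Integrable (fun ω => ∑ i, b i * W i ω) P :=
    integrable_finsetSum _ fun i _ => (hL1 i).const_mul _
  have hD : ∀ i j, MemLp (fun ω => swapIncr b (fun k => W k ω) i j) 2 P := fun i j =>
    (((hL i).sub (hL j)).const_mul (b i - b j)).neg
  have hD1 : ∀ i j, Integrable (fun ω => swapIncr b (fun k => W k ω) i j) P := fun i j =>
    (hD i j).integrable one_le_two
  have hQ : Integrable (fun ω => swapVar b (fun k => W k ω)) P :=
    (integrable_finsetSum _ fun i _ => integrable_finsetSum _ fun j _ =>
      (hD i j).integrable_sq).const_mul _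
  have hEm : ∀ s : ℝ, Measurable fun x : ℝ => Complex.exp ((s * x : ℝ) * Complex.I) := fun s => by
    fun_prop
  have hE1 : ∀ s x : ℝ, ‖Complex.exp ((s * x : ℝ) * Complex.I)‖ = 1 := fun s x =>
    Complex.norm_exp_ofReal_mul_I _
  have hmin : ∀ (s : ℝ) i j, Integrable (fun ω => |swapIncr b (fun k => W k ω) i j| *
      min |s * swapIncr b (fun k => W k ω) i j|
        ((s * swapIncr b (fun k => W k ω) i j) ^ 2)) P := by
    intro s i j
    refine ((hD i j).integrable_sq.const_mul |s|).mono' ?_ (Eventually.of_forall fun ω => ?_)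
    · have : Measurable fun x : ℝ => |x| * min |s * x| ((s * x) ^ 2) := by fun_prop
      exact (this.comp_aemeasurable (hD1 i j).aemeasurable).aestronglyMeasurable
    · rw [Real.norm_of_nonneg (by positivity)]
      calc _ ≤ |swapIncr b (fun k => W k ω) i j| * |s * swapIncr b (fun k => W k ω) i j| := by
            gcongr; exact min_le_left _ _
        _ = |s| * swapIncr b (fun k => W k ω) i j ^ 2 := by
            rw [abs_mul, ← sq_abs (swapIncr b (fun k => W k ω) i j)]; ring
  refine norm_sub_gaussian_le_of_deriv
    (φ := fun s : ℝ => ∫ ω, Complex.exp ((s * ∑ i, b i * W i ω : ℝ) * Complex.I) ∂P) ht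
    (by simp) (fun s => hasDerivAt_integral_exp_mul_I hVint s) fun s hs => ?_
  have hVE : Integrable (fun ω => Complex.exp ((s * ∑ i, b i * W i ω : ℝ) * Complex.I)) P :=
    Integrable.of_bound ((hEm s).comp_aemeasurable hVint.aemeasurable).aestronglyMeasurable 1
      (Eventually.of_forall fun ω => (hE1 s _).le)
  have hmulE : ∀ {U : Ω → ℂ}, Integrable U P →
      Integrable (fun ω => U ω * Complex.exp ((s * ∑ i, b i * W i ω : ℝ) * Complex.I)) P :=
    fun hU => hU.mul_bdd (c := 1) hVE.aestronglyMeasurable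
      (Eventually.of_forall fun ω => (hE1 s _).le)
  -- the second order Taylor remainder of the increment
  set R : ι → ι → Ω → ℂ := fun i j ω => (swapIncr b (fun k => W k ω) i j : ℂ) *
    (Complex.exp ((s * swapIncr b (fun k => W k ω) i j : ℝ) * Complex.I) - 1
      - (s * swapIncr b (fun k => W k ω) i j : ℝ) * Complex.I) with hR
  have hRle : ∀ i j ω, ‖R i j ω‖ ≤ 2 * (|swapIncr b (fun k => W k ω) i j| *
      min |r * swapIncr b (fun k => W k ω) i j|
        ((r * swapIncr b (fun k => W k ω) i j) ^ 2)) := by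
    intro i j ω
    rw [hR, norm_mul, Complex.norm_real, Real.norm_eq_abs]
    have h1 := norm_exp_mul_I_sub_one_sub_le (s * swapIncr b (fun k => W k ω) i j)
    have h2 : |s * swapIncr b (fun k => W k ω) i j| ≤ |r * swapIncr b (fun k => W k ω) i j| := by
      rw [abs_mul, abs_mul]; gcongr
    have h3 := min_le_min h2 (sq_le_sq.2 h2)
    calc _ ≤ |swapIncr b (fun k => W k ω) i j| *
          (2 * min |r * swapIncr b (fun k => W k ω) i j|
            ((r * swapIncr b (fun k => W k ω) i j) ^ 2)) := by gcongr; linarith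
      _ = _ := by ring
  have hRm : ∀ i j, AEStronglyMeasurable (R i j) P := by
    intro i j
    have : Measurable fun x : ℝ => (x : ℂ) * (Complex.exp ((s * x : ℝ) * Complex.I) - 1
      - (s * x : ℝ) * Complex.I) := by fun_prop
    exact (this.comp_aemeasurable (hD1 i j).aemeasurable).aestronglyMeasurable
  have hRint : ∀ i j, Integrable (R i j) P := fun i j =>
    ((hmin r i j).const_mul 2).mono' (hRm i j) (Eventually.of_forall (hRle i j))
  have hst := hW.integral_sum_mul_eq hL1 hb (hEm s) fun x => (hE1 s x).le
  have hpt : ∀ i j ω, (swapIncr b (fun k => W k ω) i j : ℂ) *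
      (Complex.exp ((s * (∑ i, b i * W i ω + swapIncr b (fun k => W k ω) i j) : ℝ) * Complex.I)
        - Complex.exp ((s * ∑ i, b i * W i ω : ℝ) * Complex.I))
      = (R i j ω + (s * swapIncr b (fun k => W k ω) i j ^ 2 : ℝ) * Complex.I) *
        Complex.exp ((s * ∑ i, b i * W i ω : ℝ) * Complex.I) := by
    intro i j ω
    rw [mul_add s, Complex.ofReal_add, add_mul, Complex.exp_add]
    simp only [hR]
    push_cast
    ring
  have hint1 : ∀ i j, Integrable (fun ω => (R i j ω +
      (s * swapIncr b (fun k => W k ω) i j ^ 2 : ℝ) * Complex.I) *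
        Complex.exp ((s * ∑ i, b i * W i ω : ℝ) * Complex.I)) P := fun i j =>
    hmulE ((hRint i j).add (((hD i j).integrable_sq.const_mul s).ofReal.mul_const _))
  simp_rw [hpt, ← integral_finsetSum _ fun j _ => hint1 _ j] at hst
  rw [← integral_finsetSum _ fun i _ => integrable_finsetSum _ fun j _ => hint1 i j] at hst
  have hkey : (∫ ω, Complex.I * (((∑ i, b i * W i ω : ℝ) : ℂ) *
        Complex.exp ((s * ∑ i, b i * W i ω : ℝ) * Complex.I)) ∂P)
      + (s * t : ℝ) * ∫ ω, Complex.exp ((s * ∑ i, b i * W i ω : ℝ) * Complex.I) ∂P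
      = ∫ ω, ((4 * Fintype.card ι : ℂ)⁻¹ * Complex.I * ∑ i, ∑ j, R i j ω
          - (s * (swapVar b (fun k => W k ω) - t) : ℝ)) *
          Complex.exp ((s * ∑ i, b i * W i ω : ℝ) * Complex.I) ∂P := by
    have h1 : ∫ ω, Complex.I * (((∑ i, b i * W i ω : ℝ) : ℂ) *
        Complex.exp ((s * ∑ i, b i * W i ω : ℝ) * Complex.I)) ∂P
        = ∫ ω, Complex.I * (4 * Fintype.card ι : ℂ)⁻¹ * ∑ i, ∑ j, (R i j ω +
      (s * swapIncr b (fun k => W k ω) i j ^ 2 : ℝ) * Complex.I) *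
        Complex.exp ((s * ∑ i, b i * W i ω : ℝ) * Complex.I) ∂P := by
      rw [integral_const_mul, integral_const_mul, ← hst]
      field_simp
    rw [h1, ← integral_const_mul, ← integral_add]
    · refine integral_congr_ae (Eventually.of_forall fun ω => ?_)
      simp only [swapVar, ← Finset.sum_mul, Finset.sum_add_distrib]
      push_cast
      simp only [← Finset.mul_sum]
      ring_nf
      simp only [Complex.I_sq]
      ring
    · exact (integrable_finsetSum _ fun i _ => integrable_finsetSum _ fun j _ =>
        hint1 i j).const_mul _
    · exact hVE.const_mul _
  rw [hkey]
  have hQt : Integrable (fun ω => |swapVar b (fun k => W k ω) - t|) P :=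
    (hQ.sub (integrable_const t)).abs
  calc _ ≤ ∫ ω, (|r| * |swapVar b (fun k => W k ω) - t| + (2 * Fintype.card ι : ℝ)⁻¹ *
          ∑ i, ∑ j, |swapIncr b (fun k => W k ω) i j| * min |r * swapIncr b (fun k => W k ω) i j|
        ((r * swapIncr b (fun k => W k ω) i j) ^ 2)) ∂P := by
        refine norm_integral_le_of_norm_le ?_ (Eventually.of_forall fun ω => ?_)
        · exact (hQt.const_mul _).add ((integrable_finsetSum _ fun i _ =>
            integrable_finsetSum _ fun j _ => hmin r i j).const_mul _)
        rw [norm_mul, hE1, mul_one]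
        refine (norm_sub_le _ _).trans ?_
        rw [add_comm]
        gcongr
        · rw [Complex.norm_real, Real.norm_eq_abs, abs_mul]
          gcongr
        · rw [norm_mul, norm_mul, Complex.norm_I, mul_one]
          have : ‖(4 * Fintype.card ι : ℂ)⁻¹‖ = (2 * Fintype.card ι : ℝ)⁻¹ * 2⁻¹ := by
            rw [norm_inv, norm_mul]; simp; ring
          rw [this, mul_assoc]
          gcongr
          calc 2⁻¹ * ‖∑ i, ∑ j, R i j ω‖ ≤ 2⁻¹ * ∑ i, ∑ j, ‖R i j ω‖ := by
                gcongr
                exact (norm_sum_le _ _).trans (Finset.sum_le_sum fun i _ => norm_sum_le _ _)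
            _ ≤ 2⁻¹ * ∑ i, ∑ j, 2 * (|swapIncr b (fun k => W k ω) i j| *
                  min |r * swapIncr b (fun k => W k ω) i j|
                  ((r * swapIncr b (fun k => W k ω) i j) ^ 2)) := by
                gcongr with i _ j _
                exact hRle i j ω
            _ = _ := by simp_rw [← Finset.mul_sum]; ring
    _ = _ := by
        rw [integral_add (hQt.const_mul _) ((integrable_finsetSum _ fun i _ =>
            integrable_finsetSum _ fun j _ => hmin r i j).const_mul _), integral_const_mul,
          integral_const_mul, integral_finsetSum _ fun i _ =>
            integrable_finsetSum _ fun j _ => hmin r i j]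
        simp_rw [integral_finsetSum _ fun j _ => hmin r _ j]

end CharFun

/-! ### A central limit theorem for exchangeable arrays -/

section CLT

/-- The function `x ↦ x² 1{|x| > K}`, whose mean measures the uniform integrability of squares. -/
noncomputable def tailSq (K x : ℝ) : ℝ := if K < |x| then x ^ 2 else 0

@[fun_prop]
theorem measurable_tailSq (K : ℝ) : Measurable (tailSq K) :=
  Measurable.ite (measurableSet_lt measurable_const (by fun_prop)) (by fun_prop) (by fun_prop)

theorem tailSq_nonneg (K x : ℝ) : 0 ≤ tailSq K x := by
  unfold tailSq; split_ifs <;> positivity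

theorem tailSq_le (K x : ℝ) : tailSq K x ≤ x ^ 2 := by
  unfold tailSq; split_ifs <;> nlinarith [sq_nonneg x]

theorem sq_sub_min_le_tailSq {K : ℝ} (x : ℝ) : x ^ 2 - min (x ^ 2) (K ^ 2) ≤ tailSq K x := by
  unfold tailSq
  split_ifs with h
  · have : 0 ≤ min (x ^ 2) (K ^ 2) := by positivity
    linarith
  · have : x ^ 2 ≤ K ^ 2 := by
      have := not_lt.1 h
      rw [← sq_abs x]
      exact pow_le_pow_left₀ (abs_nonneg _) this 2
    rw [min_eq_left this]; simp

theorem abs_mul_min_le_tailSq {K : ℝ} (hK : 0 ≤ K) (r c x y : ℝ) :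
    |c * (x - y)| * min |r * (c * (x - y))| ((r * (c * (x - y))) ^ 2)
      ≤ c ^ 2 * (8 * r ^ 2 * |c| * K ^ 3 + 4 * |r| * (tailSq K x + tailSq K y)) := by
  have hT := tailSq_nonneg K
  by_cases h : |x| ≤ K ∧ |y| ≤ K
  · have hd : |x - y| ≤ 2 * K := (abs_sub x y).trans (by linarith [h.1, h.2])
    calc _ ≤ |c * (x - y)| * ((r * (c * (x - y))) ^ 2) := by gcongr; exact min_le_right _ _
      _ = c ^ 2 * (r ^ 2 * |c| * |x - y| ^ 3) := by
          rw [abs_mul, show |x - y| ^ 3 = |x - y| * |x - y| ^ 2 by ring, sq_abs]; ring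
      _ ≤ c ^ 2 * (r ^ 2 * |c| * (2 * K) ^ 3) := by gcongr
      _ = c ^ 2 * (8 * r ^ 2 * |c| * K ^ 3) := by ring
      _ ≤ _ := by
          gcongr
          have := hT x; have := hT y
          have : 0 ≤ 4 * |r| * (tailSq K x + tailSq K y) := by positivity
          linarith
  · have hd : (x - y) ^ 2 ≤ 4 * (tailSq K x + tailSq K y) := by
      rcases le_total |x| |y| with hxy | hxy
      · have hy : K < |y| := by
          by_contra hcon
          exact h ⟨hxy.trans (not_lt.1 hcon), not_lt.1 hcon⟩
        have e : tailSq K y = y ^ 2 := by simp [tailSq, hy]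
        have h2 : |x - y| ≤ 2 * |y| := (abs_sub x y).trans (by linarith)
        have h3 := pow_le_pow_left₀ (abs_nonneg _) h2 2
        rw [sq_abs, mul_pow, sq_abs] at h3
        have := hT x
        linarith
      · have hx : K < |x| := by
          by_contra hcon
          exact h ⟨not_lt.1 hcon, hxy.trans (not_lt.1 hcon)⟩
        have e : tailSq K x = x ^ 2 := by simp [tailSq, hx]
        have h2 : |x - y| ≤ 2 * |x| := (abs_sub x y).trans (by linarith)
        have h3 := pow_le_pow_left₀ (abs_nonneg _) h2 2
        rw [sq_abs, mul_pow, sq_abs] at h3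
        have := hT y
        linarith
    calc _ ≤ |c * (x - y)| * |r * (c * (x - y))| := by gcongr; exact min_le_left _ _
      _ = c ^ 2 * (|r| * (x - y) ^ 2) := by
          rw [abs_mul r, ← sq_abs c, ← sq_abs (x - y), abs_mul]; ring
      _ ≤ c ^ 2 * (|r| * (4 * (tailSq K x + tailSq K y))) := by gcongr
      _ = c ^ 2 * (4 * |r| * (tailSq K x + tailSq K y)) := by ring
      _ ≤ _ := by
          gcongr
          have : 0 ≤ 8 * r ^ 2 * |c| * K ^ 3 := by positivity
          linarith

variable {Ω : Type*} [MeasurableSpace Ω] {P : Measure Ω} [IsProbabilityMeasure P]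
  {ι : Type*} [Fintype ι]

theorem sum_sum_sub_sq (b : ι → ℝ) (hb : ∑ i, b i = 0) :
    ∑ i, ∑ j, (b i - b j) ^ 2 = 2 * Fintype.card ι * ∑ i, b i ^ 2 := by
  have h : ∀ i, ∑ j, (b i - b j) ^ 2 = Fintype.card ι * b i ^ 2 + ∑ j, b j ^ 2 := by
    intro i
    have : ∀ j, (b i - b j) ^ 2 = b i ^ 2 - 2 * b i * b j + b j ^ 2 := fun j => by ring
    simp only [this, Finset.sum_sub_distrib, Finset.sum_add_distrib, ← Finset.mul_sum, hb]
    simp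
  simp only [h, Finset.sum_add_distrib, ← Finset.mul_sum]
  simp
  ring

/-- The deviation of the mean square increment from `t`. The first sum has coefficients of sum
zero, so that it is small after truncation. -/
theorem swapVar_sub_eq [Nonempty ι] (b w : ι → ℝ) (hb : ∑ i, b i = 0) (t : ℝ) :
    swapVar b w - t
      = 2⁻¹ * ∑ i, (b i ^ 2 - (∑ i, b i ^ 2) / Fintype.card ι) * w i ^ 2
        + (∑ i, b i ^ 2) * ((∑ i, w i ^ 2) / Fintype.card ι - 1) + (∑ i, b i ^ 2 - t)
        - ∑ i, b i ^ 2 * ((∑ j, w j) / Fintype.card ι * w i)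
        + (∑ i, b i * w i) ^ 2 / Fintype.card ι := by
  have hN : (Fintype.card ι : ℝ) ≠ 0 := by simp
  rw [swapVar, sum_swapIncr_sq b w hb]
  have h1 : ∑ i, (b i ^ 2 - (∑ i, b i ^ 2) / Fintype.card ι) * w i ^ 2
      = ∑ i, b i ^ 2 * w i ^ 2 - (∑ i, b i ^ 2) / Fintype.card ι * ∑ i, w i ^ 2 := by
    rw [Finset.mul_sum, ← Finset.sum_sub_distrib]
    exact Finset.sum_congr rfl fun i _ => by ring
  have h2 : ∑ i, b i ^ 2 * ((∑ j, w j) / Fintype.card ι * w i)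
      = (∑ j, w j) / Fintype.card ι * ∑ i, b i ^ 2 * w i := by
    rw [Finset.mul_sum]
    exact Finset.sum_congr rfl fun i _ => by ring
  rw [h1, h2]
  field_simp
  ring

/-- The mean square increment is close to `t` in `L¹`, given bounds for the tails of the squares
(`T`), for their average (`η`) and for the average of the variables (`ε`). -/
theorem Exchangeable.integral_abs_swapVar_sub_le [DecidableEq ι] [Nonempty ι] {W : ι → Ω → ℝ}
    (hW : Exchangeable P W) (hL : ∀ i, MemLp (W i) 2 P) (hv : ∀ i, ∫ ω, W i ω ^ 2 ∂P = 1)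
    {b : ι → ℝ} (hb : ∑ i, b i = 0) (t : ℝ) {K T η ε : ℝ} (hε : 0 ≤ ε)
    (hT : ∀ i, ∫ ω, tailSq K (W i ω) ∂P ≤ T)
    (hη : ∫ ω, |(∑ i, W i ω ^ 2) / Fintype.card ι - 1| ∂P ≤ η)
    (hεW : ∫ ω, ((∑ i, W i ω) / Fintype.card ι) ^ 2 ∂P ≤ ε ^ 2) :
    ∫ ω, |swapVar b (fun k => W k ω) - t| ∂P
      ≤ K ^ 2 * √(∑ i, b i ^ 4) + (∑ i, b i ^ 2) * (T + η + ε + 2 / Fintype.card ι)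
        + |∑ i, b i ^ 2 - t| := by
  set N : ℝ := (Fintype.card ι : ℝ) with hN
  have hN0 : 0 < N := by simp [hN, Fintype.card_pos]
  set B : ℝ := ∑ i, b i ^ 2 with hB
  have hB0 : 0 ≤ B := Finset.sum_nonneg fun i _ => sq_nonneg _
  set α : ι → ℝ := fun i => b i ^ 2 - B / N with hα
  have hα0 : ∑ i, α i = 0 := by
    simp only [hα, Finset.sum_sub_distrib]
    simp [← hN, ← hB]
    field_simp; simp
  have hα2 : ∑ i, α i ^ 2 ≤ ∑ i, b i ^ 4 := by
    have : ∀ i, α i ^ 2 = b i ^ 4 - 2 * (B / N) * b i ^ 2 + (B / N) ^ 2 := fun i => by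
      simp only [hα]; ring
    simp only [this, Finset.sum_add_distrib, Finset.sum_sub_distrib, ← Finset.mul_sum, ← hB]
    simp only [Finset.sum_const, Finset.card_univ, nsmul_eq_mul, ← hN]
    have : 2 * (B / N) * B - N * (B / N) ^ 2 = B ^ 2 / N := by field_simp; ring
    have : 0 ≤ B ^ 2 / N := by positivity
    linarith
  have hα1 : ∑ i, |α i| ≤ 2 * B := by
    calc ∑ i, |α i| ≤ ∑ i, (b i ^ 2 + B / N) := by
          refine Finset.sum_le_sum fun i _ => (abs_sub _ _).trans ?_
          rw [abs_of_nonneg (sq_nonneg _), abs_of_nonneg (by positivity)]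
      _ = 2 * B := by
          rw [Finset.sum_add_distrib]; simp [← hN, ← hB]; field_simp; ring
  have hWm : ∀ i, AEMeasurable (W i) P := fun i => (hL i).aemeasurable
  set g : ℝ → ℝ := fun x => min (x ^ 2) (K ^ 2) with hg
  have hgm : Measurable g := by fun_prop
  have hg0 : ∀ x, 0 ≤ g x := fun x => by simp only [hg]; positivity
  have hgK : ∀ x, g x ≤ K ^ 2 := fun x => min_le_right _ _
  have hYL : ∀ i, MemLp (fun ω => g (W i ω)) 2 P := fun i =>
    MemLp.of_bound (hgm.comp_aemeasurable (hWm i)).aestronglyMeasurable (K ^ 2)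
      (Eventually.of_forall fun ω => by
        rw [Real.norm_of_nonneg (hg0 _)]; exact hgK _)
  have hTint : ∀ i, Integrable (fun ω => tailSq K (W i ω)) P := fun i =>
    (hL i).integrable_sq.mono' ((measurable_tailSq K).comp_aemeasurable
      (hWm i)).aestronglyMeasurable (Eventually.of_forall fun ω => by
        rw [Real.norm_of_nonneg (tailSq_nonneg _ _)]; exact tailSq_le _ _)
  have hS1 : MemLp (fun ω => (∑ i, W i ω) / N) 2 P := by
    simp_rw [div_eq_mul_inv]
    exact (memLp_finsetSum _ fun i _ => hL i).mul_const _
  have hS2 : Integrable (fun ω => |(∑ i, W i ω ^ 2) / N - 1|) P :=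
    (((integrable_finsetSum _ fun i _ => (hL i).integrable_sq).div_const _).sub
      (integrable_const 1)).abs
  have hV : MemLp (fun ω => ∑ i, b i * W i ω) 2 P :=
    memLp_finsetSum _ fun i _ => (hL i).const_mul _
  have hY : MemLp (fun ω => ∑ i, α i * g (W i ω)) 2 P :=
    memLp_finsetSum _ fun i _ => (hYL i).const_mul _
  -- the terms of `swapVar_sub_eq`, the squares in the first one being truncated at `K ^ 2`; the
  -- truncated part is handled in `L²`, where exchangeability makes the sum almost uncorrelated
  have c1 : ∫ ω, |∑ i, α i * g (W i ω)| ∂P ≤ 2 * (K ^ 2 * √(∑ i, b i ^ 4)) := by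
    have i0 : ι := Classical.arbitrary ι
    have hvv : ∀ i, ∫ ω, g (W i ω) ^ 2 ∂P = ∫ ω, g (W i0 ω) ^ 2 ∂P := fun i =>
      ((hW.identDistrib i i0).comp (u := fun x => g x ^ 2) (by fun_prop)).integral_eq
    have hvK : ∫ ω, g (W i0 ω) ^ 2 ∂P ≤ K ^ 4 := by
      calc _ ≤ ∫ _, K ^ 4 ∂P := by
            refine integral_mono (hYL i0).integrable_sq (integrable_const _) fun ω => ?_
            calc g (W i0 ω) ^ 2 ≤ (K ^ 2) ^ 2 := pow_le_pow_left₀ (hg0 _) (hgK _) 2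
              _ = K ^ 4 := by ring
        _ = K ^ 4 := by simp
    calc _ ≤ √(∫ ω, (∑ i, α i * g (W i ω)) ^ 2 ∂P) := integral_abs_le_sqrt hY
      _ ≤ √((2 * K ^ 2) ^ 2 * ∑ i, b i ^ 4) := by
          apply Real.sqrt_le_sqrt
          refine (hW.integral_comp_sq_sum_le hgm hYL hvv hα0).trans ?_
          have h4 : 0 ≤ ∑ i, α i ^ 2 := Finset.sum_nonneg fun i _ => sq_nonneg _
          calc _ ≤ 2 * K ^ 4 * ∑ i, α i ^ 2 := by gcongr
            _ ≤ 2 * K ^ 4 * ∑ i, b i ^ 4 := by gcongr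
            _ ≤ (2 * K ^ 2) ^ 2 * ∑ i, b i ^ 4 := by
                rw [mul_pow]
                have h5 : 0 ≤ ∑ i, b i ^ 4 := h4.trans hα2
                have : 0 ≤ K ^ 4 * ∑ i, b i ^ 4 := by positivity
                nlinarith
      _ = _ := by
          rw [Real.sqrt_mul (by positivity), Real.sqrt_sq (by positivity)]; ring
  have c2 : ∫ ω, ∑ i, |α i| * tailSq K (W i ω) ∂P ≤ 2 * (B * T) := by
    have hT0 : 0 ≤ T := (integral_nonneg fun ω => tailSq_nonneg K (W (Classical.arbitrary ι) ω)).trans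
      (hT _)
    rw [integral_finsetSum _ fun i _ => (hTint i).const_mul _]
    simp_rw [integral_const_mul]
    calc _ ≤ ∑ i, |α i| * T := by gcongr with i _; exact hT i
      _ = (∑ i, |α i|) * T := by rw [Finset.sum_mul]
      _ ≤ 2 * B * T := by gcongr
      _ = _ := by ring
  have c4i : ∀ i, Integrable (fun ω => |(∑ j, W j ω) / N * W i ω|) P := fun i =>
    (integrable_mul_of_memLp_two hS1 (hL i)).abs
  have c4 : ∫ ω, ∑ i, b i ^ 2 * |(∑ j, W j ω) / N * W i ω| ∂P ≤ B * ε := by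
    rw [integral_finsetSum _ fun i _ => (c4i i).const_mul _]
    simp_rw [integral_const_mul]
    rw [hB, Finset.sum_mul]
    gcongr with i _
    calc _ ≤ √(∫ ω, ((∑ j, W j ω) / N) ^ 2 ∂P) * √(∫ ω, W i ω ^ 2 ∂P) :=
          integral_abs_mul_le_sqrt hS1 (hL i)
      _ ≤ √(ε ^ 2) * 1 := by
          rw [hv i, Real.sqrt_one]; gcongr
      _ = ε := by rw [Real.sqrt_sq hε, mul_one]
  have c5 : ∫ ω, (∑ i, b i * W i ω) ^ 2 / N ∂P ≤ B * (2 / N) := by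
    rw [integral_div]
    have := hW.integral_comp_sq_sum_le measurable_id hL hv hb
    calc _ ≤ (2 * 1 * B) / N := by gcongr; exact this
      _ = _ := by ring
  have hint1 := (hY.integrable one_le_two).abs
  have hint2 : Integrable (fun ω => ∑ i, |α i| * tailSq K (W i ω)) P :=
    integrable_finsetSum _ fun i _ => (hTint i).const_mul _
  have hint4 : Integrable (fun ω => ∑ i, b i ^ 2 * |(∑ j, W j ω) / N * W i ω|) P :=
    integrable_finsetSum _ fun i _ => (c4i i).const_mul _
  have hint5 : Integrable (fun ω => (∑ i, b i * W i ω) ^ 2 / N) P := hV.integrable_sq.div_const _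
  calc ∫ ω, |swapVar b (fun k => W k ω) - t| ∂P
      ≤ ∫ ω, (2⁻¹ * |∑ i, α i * g (W i ω)| + 2⁻¹ * ∑ i, |α i| * tailSq K (W i ω)
          + B * |(∑ i, W i ω ^ 2) / N - 1| + |B - t|
          + ∑ i, b i ^ 2 * |(∑ j, W j ω) / N * W i ω|
          + (∑ i, b i * W i ω) ^ 2 / N) ∂P := by
        refine integral_mono_of_nonneg (Eventually.of_forall fun _ => abs_nonneg _) ?_
          (Eventually.of_forall fun ω => ?_)
        · exact (((((hint1.const_mul _).add (hint2.const_mul _)).add (hS2.const_mul _)).add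
            (integrable_const _)).add hint4).add hint5
        simp only
        rw [swapVar_sub_eq b (fun k => W k ω) hb t, ← hN, ← hB]
        have e1 : |∑ i, (b i ^ 2 - B / N) * W i ω ^ 2|
            ≤ |∑ i, α i * g (W i ω)| + ∑ i, |α i| * tailSq K (W i ω) := by
          have : ∑ i, (b i ^ 2 - B / N) * W i ω ^ 2
              = ∑ i, α i * g (W i ω) + ∑ i, α i * (W i ω ^ 2 - g (W i ω)) := by
            rw [← Finset.sum_add_distrib]
            exact Finset.sum_congr rfl fun i _ => by simp only [hα]; ring
          rw [this]
          refine (abs_add_le _ _).trans ?_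
          gcongr
          refine (Finset.abs_sum_le_sum_abs _ _).trans (Finset.sum_le_sum fun i _ => ?_)
          rw [abs_mul, abs_of_nonneg (a := W i ω ^ 2 - g (W i ω)) (sub_nonneg.2 (min_le_left _ _))]
          gcongr
          exact sq_sub_min_le_tailSq _
        have e4 : |∑ i, b i ^ 2 * ((∑ j, W j ω) / N * W i ω)|
            ≤ ∑ i, b i ^ 2 * |(∑ j, W j ω) / N * W i ω| := by
          refine (Finset.abs_sum_le_sum_abs _ _).trans (Finset.sum_le_sum fun i _ => ?_)
          rw [abs_mul, abs_of_nonneg (sq_nonneg (b i))]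
        have e3 : |B * ((∑ i, W i ω ^ 2) / N - 1)| = B * |(∑ i, W i ω ^ 2) / N - 1| := by
          rw [abs_mul, abs_of_nonneg hB0]
        have e5 : 0 ≤ (∑ i, b i * W i ω) ^ 2 / N := by positivity
        have := abs_le.1 e1
        have := abs_le.1 e4
        have := abs_le.1 e3.le
        have := abs_le.1 (le_refl |B - t|)
        rw [abs_le]
        constructor <;> linarith
    _ = 2⁻¹ * ∫ ω, |∑ i, α i * g (W i ω)| ∂P + 2⁻¹ * ∫ ω, ∑ i, |α i| * tailSq K (W i ω) ∂P
          + B * ∫ ω, |(∑ i, W i ω ^ 2) / N - 1| ∂P + |B - t|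
          + ∫ ω, ∑ i, b i ^ 2 * |(∑ j, W j ω) / N * W i ω| ∂P
          + ∫ ω, (∑ i, b i * W i ω) ^ 2 / N ∂P := by
        have d2 : Integrable (fun ω => 2⁻¹ * |∑ i, α i * g (W i ω)|
            + 2⁻¹ * ∑ i, |α i| * tailSq K (W i ω)) P := (hint1.const_mul _).add (hint2.const_mul _)
        have d3 : Integrable (fun ω => 2⁻¹ * |∑ i, α i * g (W i ω)|
            + 2⁻¹ * ∑ i, |α i| * tailSq K (W i ω) + B * |(∑ i, W i ω ^ 2) / N - 1|) P :=
          d2.add (hS2.const_mul _)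
        have d4 : Integrable (fun ω => 2⁻¹ * |∑ i, α i * g (W i ω)|
            + 2⁻¹ * ∑ i, |α i| * tailSq K (W i ω) + B * |(∑ i, W i ω ^ 2) / N - 1|
            + |B - t|) P := d3.add (integrable_const _)
        have d5 : Integrable (fun ω => 2⁻¹ * |∑ i, α i * g (W i ω)|
            + 2⁻¹ * ∑ i, |α i| * tailSq K (W i ω) + B * |(∑ i, W i ω ^ 2) / N - 1|
            + |B - t| + ∑ i, b i ^ 2 * |(∑ j, W j ω) / N * W i ω|) P := d4.add hint4
        rw [integral_add d5 hint5, integral_add d4 hint4,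
          integral_add d3 (integrable_const _), integral_add d2 (hS2.const_mul _),
          integral_add (hint1.const_mul _) (hint2.const_mul _), integral_const_mul,
          integral_const_mul, integral_const_mul]
        simp
    _ ≤ _ := by
        have : B * ∫ ω, |(∑ i, W i ω ^ 2) / N - 1| ∂P ≤ B * η := by gcongr
        linarith

/-- Bound for the Taylor remainders: increments of entries at most `K` are of third order in the
coefficients, the others are controlled by the tails of the squares. -/
theorem sum_integral_incr_le {W : ι → Ω → ℝ}
    (hL : ∀ i, MemLp (W i) 2 P) {b : ι → ℝ} (hb : ∑ i, b i = 0) {K T β : ℝ} (hK : 0 ≤ K)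
    (hT : ∀ i, ∫ ω, tailSq K (W i ω) ∂P ≤ T) (hβ : ∀ i, |b i| ≤ β) (r : ℝ) :
    (2 * Fintype.card ι : ℝ)⁻¹ * ∑ i, ∑ j, ∫ ω, |swapIncr b (fun k => W k ω) i j| *
            min |r * swapIncr b (fun k => W k ω) i j|
              ((r * swapIncr b (fun k => W k ω) i j) ^ 2) ∂P
      ≤ (∑ i, b i ^ 2) * (16 * r ^ 2 * β * K ^ 3 + 8 * |r| * T) := by
  have hTint : ∀ i, Integrable (fun ω => tailSq K (W i ω)) P := fun i =>
    (hL i).integrable_sq.mono' ((measurable_tailSq K).comp_aemeasurable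
      (hL i).aemeasurable).aestronglyMeasurable (Eventually.of_forall fun ω => by
        rw [Real.norm_of_nonneg (tailSq_nonneg _ _)]; exact tailSq_le _ _)
  have hij : ∀ i j, ∫ ω, |swapIncr b (fun k => W k ω) i j| *
            min |r * swapIncr b (fun k => W k ω) i j|
              ((r * swapIncr b (fun k => W k ω) i j) ^ 2) ∂P
      ≤ (b i - b j) ^ 2 * (16 * r ^ 2 * β * K ^ 3 + 8 * |r| * T) := by
    intro i j
    have hint : Integrable (fun ω => (b i - b j) ^ 2 * (8 * r ^ 2 * |b i - b j| * K ^ 3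
          + 4 * |r| * (tailSq K (W i ω) + tailSq K (W j ω)))) P :=
      ((integrable_const _).add (((hTint i).add (hTint j)).const_mul _)).const_mul _
    calc _ ≤ ∫ ω, (b i - b j) ^ 2 * (8 * r ^ 2 * |b i - b j| * K ^ 3
          + 4 * |r| * (tailSq K (W i ω) + tailSq K (W j ω))) ∂P := by
          refine integral_mono_of_nonneg (Eventually.of_forall fun _ => by positivity) hint
            (Eventually.of_forall fun ω => ?_)
          simpa only [swapIncr, mul_neg, abs_neg, neg_sq] using
            abs_mul_min_le_tailSq hK r (b i - b j) (W i ω) (W j ω)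
      _ = (b i - b j) ^ 2 * (8 * r ^ 2 * |b i - b j| * K ^ 3
          + 4 * |r| * (∫ ω, tailSq K (W i ω) ∂P + ∫ ω, tailSq K (W j ω) ∂P)) := by
          have h2 : Integrable (fun ω => tailSq K (W i ω) + tailSq K (W j ω)) P :=
            (hTint i).add (hTint j)
          rw [integral_const_mul, integral_add (integrable_const _) (h2.const_mul _),
            integral_const_mul (4 * |r|), integral_add (hTint i) (hTint j)]
          simp
      _ ≤ (b i - b j) ^ 2 * (8 * r ^ 2 * (2 * β) * K ^ 3 + 4 * |r| * (T + T)) := by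
          have h1 : |b i - b j| ≤ 2 * β := (abs_sub _ _).trans (by linarith [hβ i, hβ j])
          gcongr
          · exact hT i
          · exact hT j
      _ = _ := by ring
  calc _ ≤ (2 * Fintype.card ι : ℝ)⁻¹ * ∑ i, ∑ j,
        (b i - b j) ^ 2 * (16 * r ^ 2 * β * K ^ 3 + 8 * |r| * T) := by
        gcongr with i _ j _
        exact hij i j
    _ = ((2 * Fintype.card ι : ℝ)⁻¹ * (2 * Fintype.card ι)) * (∑ i, b i ^ 2) *
        (16 * r ^ 2 * β * K ^ 3 + 8 * |r| * T) := by
        simp_rw [← Finset.sum_mul]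
        rw [sum_sum_sub_sq b hb]
        ring
    _ = _ := by
        rcases isEmpty_or_nonempty ι with h | h
        · simp
        · rw [inv_mul_cancel₀ (by simp), one_mul]

/-- Central limit theorem for linear combinations of exchangeable rows, in terms of
characteristic functions. -/
theorem tendsto_charFun_of_exchangeable {n : ℕ → ℕ} (hn : Tendsto n atTop atTop)
    {W : ∀ k, Fin (n k) → Ω → ℝ} {b : ∀ k, Fin (n k) → ℝ} {t : ℝ} (ht : 0 ≤ t)
    (hW : ∀ᶠ k in atTop, Exchangeable P (W k))
    (hL : ∀ᶠ k in atTop, ∀ i, MemLp (W k i) 2 P)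
    (hv : ∀ᶠ k in atTop, ∀ i, ∫ ω, W k i ω ^ 2 ∂P = 1)
    (hmean : Tendsto (fun k => ∫ ω, ((∑ i, W k i ω) / n k) ^ 2 ∂P) atTop (𝓝 0))
    (hsq : Tendsto (fun k => ∫ ω, |(∑ i, W k i ω ^ 2) / n k - 1| ∂P) atTop (𝓝 0))
    (htail : ∀ T : ℝ, 0 < T → ∃ K : ℝ, 0 ≤ K ∧
      ∀ᶠ k in atTop, ∀ i, ∫ ω, tailSq K (W k i ω) ∂P ≤ T)
    (hb : ∀ᶠ k in atTop, ∑ i, b k i = 0)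
    (hb2 : Tendsto (fun k => ∑ i, b k i ^ 2) atTop (𝓝 t))
    (hb4 : Tendsto (fun k => ∑ i, b k i ^ 4) atTop (𝓝 0)) (r : ℝ) :
    Tendsto (fun k => ∫ ω, Complex.exp ((r * ∑ i, b k i * W k i ω : ℝ) * Complex.I) ∂P) atTop
      (𝓝 ((Real.exp (-(r ^ 2 * t / 2)) : ℝ) : ℂ)) := by
  rw [tendsto_iff_norm_sub_tendsto_zero]
  refine Metric.tendsto_nhds.2 fun e he => ?_
  obtain ⟨T, hT0, hTe⟩ : ∃ T : ℝ, 0 < T ∧ 9 * r ^ 2 * t * T < e := by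
    refine ⟨e / (9 * r ^ 2 * t + 1), by positivity, ?_⟩
    rw [mul_div_assoc', div_lt_iff₀ (by positivity)]
    nlinarith
  obtain ⟨K, hK, hKT⟩ := htail T hT0
  have hlim : Tendsto (fun k => (|r| * (K ^ 2 * √(∑ i, b k i ^ 4)
      + (∑ i, b k i ^ 2) * (T + ∫ ω, |(∑ i, W k i ω ^ 2) / n k - 1| ∂P
        + √(∫ ω, ((∑ i, W k i ω) / n k) ^ 2 ∂P) + 2 / (n k : ℝ)) + |∑ i, b k i ^ 2 - t|)
      + (∑ i, b k i ^ 2) * (16 * r ^ 2 * √(√(∑ i, b k i ^ 4)) * K ^ 3 + 8 * |r| * T)) * |r|)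
      atTop (𝓝 ((|r| * (K ^ 2 * √0 + t * (T + 0 + √0 + 0) + |t - t|)
        + t * (16 * r ^ 2 * √(√0) * K ^ 3 + 8 * |r| * T)) * |r|)) := by
    have h2n : Tendsto (fun k => 2 / (n k : ℝ)) atTop (𝓝 0) :=
      (tendsto_const_nhds.div_atTop tendsto_natCast_atTop_atTop).comp hn
    exact (((((hb4.sqrt.const_mul _).add (hb2.mul (((hsq.const_add T).add hmean.sqrt).add
      h2n))).add (hb2.sub_const t).abs).const_mul _).add
      (hb2.mul (((hb4.sqrt.sqrt.const_mul _).mul_const _).add_const _))).mul_const _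
  have hval : (|r| * (K ^ 2 * √0 + t * (T + 0 + √0 + 0) + |t - t|)
        + t * (16 * r ^ 2 * √(√0) * K ^ 3 + 8 * |r| * T)) * |r| = 9 * r ^ 2 * t * T := by
    rw [← sq_abs r]; simp only [Real.sqrt_zero, sub_self, abs_zero]; ring
  rw [hval] at hlim
  filter_upwards [hlim.eventually_lt_const hTe, hW, hL, hv, hKT, hb, hn.eventually_ge_atTop 1]
    with k h1 hW hL hv hKT hb hn1
  have : Nonempty (Fin (n k)) := ⟨⟨0, hn1⟩⟩
  rw [dist_zero_right, norm_norm]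
  refine lt_of_le_of_lt ?_ h1
  refine (hW.norm_charFun_sub_le hL hb ht r).trans ?_
  have hβ : ∀ i, |b k i| ≤ √(√(∑ i, b k i ^ 4)) := by
    intro i
    apply Real.le_sqrt_of_sq_le
    apply Real.le_sqrt_of_sq_le
    rw [sq_abs, ← pow_mul]
    exact Finset.single_le_sum (f := fun i => b k i ^ 4)
      (fun j _ => by positivity) (Finset.mem_univ i)
  have hA := hW.integral_abs_swapVar_sub_le hL hv hb t (K := K)
    (ε := √(∫ ω, ((∑ i, W k i ω) / n k) ^ 2 ∂P)) (Real.sqrt_nonneg _) hKT le_rfl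
    (by rw [Real.sq_sqrt (integral_nonneg fun _ => sq_nonneg _)]; simp)
  have hB := sum_integral_incr_le hL hb hK hKT hβ r
  simp only [Fintype.card_fin] at hA hB ⊢
  gcongr

end CLT

/-! ### The standardized bootstrap weights -/

section Weights

variable {Ω : Type*} [MeasurableSpace Ω] {P : Measure Ω}

/-- Nonnegative variables of mean one which converge to one in probability converge in `L¹`. -/
theorem tendsto_integral_abs_sub_one [IsProbabilityMeasure P] {M : ℕ → Ω → ℝ}
    (h0 : ∀ n ω, 0 ≤ M n ω)
    (hi : ∀ n, Integrable (M n) P) (h1 : ∀ᶠ n in atTop, ∫ ω, M n ω ∂P = 1)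
    (hM : TendstoInMeasure P M atTop fun _ => 1) :
    Tendsto (fun n => ∫ ω, |M n ω - 1| ∂P) atTop (𝓝 0) := by
  refine Metric.tendsto_nhds.2 fun e he => ?_
  have hm := (tendstoInMeasure_iff_measureReal_norm.1 hM) (e / 8) (by positivity)
  filter_upwards [h1, hm.eventually_lt_const (show 0 < e / 8 by positivity)] with n h1 h2
  rw [Real.dist_eq, sub_zero, abs_of_nonneg (integral_nonneg fun _ => abs_nonneg _)]
  have hset : NullMeasurableSet {ω | e / 8 ≤ ‖M n ω - 1‖} P :=
    nullMeasurableSet_le aemeasurable_const ((hi n).aemeasurable.sub_const 1).norm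
  have hind : Integrable ({ω | e / 8 ≤ ‖M n ω - 1‖}.indicator fun _ => (1 : ℝ)) P :=
    (integrable_const (1 : ℝ)).indicator₀ hset
  have hM1 : Integrable (fun ω => M n ω - 1) P := (hi n).sub (integrable_const 1)
  calc ∫ ω, |M n ω - 1| ∂P
      ≤ ∫ ω, ((M n ω - 1) + 2 * (e / 8 + {ω | e / 8 ≤ ‖M n ω - 1‖}.indicator
          (fun _ => (1 : ℝ)) ω)) ∂P := by
        refine integral_mono hM1.abs
          (hM1.add (((integrable_const _).add hind).const_mul 2)) fun ω => ?_
        simp only [Set.indicator, Set.mem_ofPred_eq, Real.norm_eq_abs]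
        split_ifs with h
        · have := h0 n ω
          rcases abs_cases (M n ω - 1) with h' | h' <;> linarith
        · have := abs_lt.1 (not_le.1 h)
          rcases abs_cases (M n ω - 1) with h' | h' <;> linarith
    _ = 2 * (e / 8 + P.real {ω | e / 8 ≤ ‖M n ω - 1‖}) := by
        have hsum : Integrable (fun ω => e / 8 + {ω | e / 8 ≤ ‖M n ω - 1‖}.indicator
            (fun _ => (1 : ℝ)) ω) P := (integrable_const _).add hind
        rw [integral_add hM1 (hsum.const_mul 2), integral_const_mul,
          integral_add (integrable_const _) hind, integral_sub (hi n) (integrable_const 1), h1,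
          integral_indicator₀ hset]
        simp
    _ < e := by linarith

variable {X : ℕ → Ω → ℝ} {w : ℕ → ℕ → Ω → ℝ}

/-- The `n`-th row of standardized weights, as a random vector. -/
noncomputable def stdRow (P : Measure Ω) (w : ℕ → ℕ → Ω → ℝ) (n : ℕ) (i : Fin n) (ω : Ω) : ℝ :=
  stdWeight P w n (i + 1) ω

theorem sum_Icc_one_eq (n : ℕ) (f : ℕ → ℝ) :
    ∑ t ∈ Finset.Icc 1 n, f t = ∑ i : Fin n, f (i + 1) := by
  rw [Finset.sum_fin_eq_sum_range]
  rw [← Finset.Ico_add_one_right_eq_Icc, Finset.sum_Ico_eq_sum_range]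
  refine Finset.sum_congr rfl fun i hi => ?_
  simp [Finset.mem_range.1 hi, add_comm]

namespace IsBootstrapWeights

variable (hw : IsBootstrapWeights P X w)
include hw

theorem measurable_row (n : ℕ) (i : Fin n) : Measurable (w n (i + 1)) :=
  hw.measurable_w n _ (Finset.mem_Icc.2 ⟨by omega, by omega⟩)

theorem memLp_row (n : ℕ) (i : Fin n) : MemLp (w n (i + 1)) 2 P :=
  hw.memLp_two n _ (Finset.mem_Icc.2 ⟨by omega, by omega⟩)

theorem measurable_stdRow (n : ℕ) (i : Fin n) : Measurable (stdRow P w n i) :=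
  ((hw.measurable_row n i).sub_const 1).const_mul _

theorem exchangeable_stdRow (n : ℕ) : Exchangeable P (stdRow P w n) := fun π =>
  (hw.exchangeable n π).comp
    (u := fun v i => (weightSd P w n)⁻¹ * (v i - 1)) (by fun_prop)

theorem exchangeable_row (n : ℕ) : Exchangeable P fun (i : Fin n) ω => w n (i + 1) ω :=
  fun π => hw.exchangeable n π

theorem weightSd_pos : ∀ᶠ n in atTop, 0 < weightSd P w n := by
  obtain ⟨k, hk, h⟩ := hw.variance_lower
  filter_upwards [h] with n hn
  have h0 : 0 ≤ weightSd P w n := Real.sqrt_nonneg _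
  rcases h0.eq_or_lt with h1 | h1
  · rw [← h1] at hn; norm_num at hn; linarith
  · exact h1

theorem integral_stdRow_sq : ∀ᶠ n in atTop, ∀ i, ∫ ω, stdRow P w n i ω ^ 2 ∂P = 1 := by
  filter_upwards [hw.pw.second_moment] with n hn i
  exact hn _ (Finset.mem_Icc.2 ⟨by omega, by omega⟩)

theorem integral_stdRow_mul {n : ℕ} {i j : Fin n} (hij : i ≠ j) :
    ∫ ω, stdRow P w n i ω * stdRow P w n j ω ∂P
      = (weightSd P w n ^ 2)⁻¹ * cov[w n 1, w n 2; P] := by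
  have hn : 2 ≤ n := by
    have := i.2; have := j.2; have : (i : ℕ) ≠ j := fun h => hij (Fin.ext h)
    omega
  set i0 : Fin n := ⟨0, by omega⟩
  set i1 : Fin n := ⟨1, by omega⟩
  have h01 : i0 ≠ i1 := by simp [i0, i1]
  have hm1 : ∫ ω, w n 1 ω ∂P = 1 := hw.mean_one n (by omega)
  have hm2 : ∫ ω, w n 2 ω ∂P = 1 := by
    rw [← hm1]
    exact ((hw.exchangeable_row n).identDistrib i1 i0).integral_eq
  have h := (((hw.exchangeable_stdRow n).identDistrib_pair hij h01).comp
    (u := fun p : ℝ × ℝ => p.1 * p.2) (by fun_prop)).integral_eq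
  refine h.trans ?_
  rw [ProbabilityTheory.covariance, hm1, hm2, ← integral_const_mul]
  refine integral_congr_ae (Eventually.of_forall fun ω => ?_)
  simp only [Function.comp_def, stdRow, stdWeight, i0, i1]
  ring

theorem tendsto_covariance_stdRow :
    Tendsto (fun n => (weightSd P w n ^ 2)⁻¹ * cov[w n 1, w n 2; P]) atTop (𝓝 0) := by
  obtain ⟨k, hk, h⟩ := hw.variance_lower
  have hc : Tendsto (fun n => cov[w n 1, w n 2; P]) atTop (𝓝 0) :=
    hw.covariance.trans_tendsto tendsto_inv_atTop_nhds_zero_nat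
  have hb : (fun n => (weightSd P w n ^ 2)⁻¹) =O[atTop] fun _ => (1 : ℝ) := by
    refine IsBigO.of_bound k⁻¹ ?_
    filter_upwards [h] with n hn
    rw [norm_one, mul_one, Real.norm_of_nonneg (by positivity)]
    exact inv_anti₀ hk hn.le
  have := hb.mul_isLittleO ((isLittleO_one_iff ℝ).2 hc)
  simpa using this

theorem exists_integral_tailSq_le (T : ℝ) (hT : 0 < T) : ∃ K : ℝ, 0 ≤ K ∧
    ∀ᶠ n in atTop, ∀ i, ∫ ω, tailSq K (stdRow P w n i ω) ∂P ≤ T := by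
  have h := hw.pw.tail.eventually_lt_const
    (show (0 : ℝ≥0∞) < ENNReal.ofReal (√T) by simpa using Real.sqrt_pos.2 hT)
  obtain ⟨K, hK, hK0⟩ := (h.and (eventually_ge_atTop (0 : ℝ))).exists
  refine ⟨K, hK0, ?_⟩
  filter_upwards [eventually_lt_of_limsup_lt hK, eventually_ge_atTop 1] with n hn hn1 i
  set i0 : Fin n := ⟨0, hn1⟩
  have hid : ∫ ω, tailSq K (stdRow P w n i ω) ∂P = ∫ ω, tailSq K (stdRow P w n i0 ω) ∂P :=
    (((hw.exchangeable_stdRow n).identDistrib i i0).comp (measurable_tailSq K)).integral_eq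
  have hU : Measurable (stdWeight P w n 1) := hw.measurable_stdRow n i0
  have hlt : ∫⁻ ω in {ω | K < |stdWeight P w n 1 ω|},
      ENNReal.ofReal ((stdWeight P w n 1 ω) ^ 2) ∂P ≤ ENNReal.ofReal T := by
    have h2 := ENNReal.rpow_le_rpow hn.le (show (0 : ℝ) ≤ 2 by norm_num)
    rw [← ENNReal.rpow_mul] at h2
    norm_num at h2
    rwa [← ENNReal.ofReal_pow (Real.sqrt_nonneg _), Real.sq_sqrt hT.le] at h2
  rw [hid, integral_eq_lintegral_of_nonneg_ae (Eventually.of_forall fun _ => tailSq_nonneg _ _)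
    ((measurable_tailSq K).comp (hw.measurable_stdRow n i0)).aestronglyMeasurable]
  refine ENNReal.toReal_le_of_le_ofReal hT.le (le_trans (le_of_eq ?_) hlt)
  rw [← lintegral_indicator (measurableSet_lt measurable_const (by fun_prop))]
  refine lintegral_congr fun ω => ?_
  simp only [tailSq, Set.indicator, Set.mem_ofPred_eq, stdRow, i0]
  simp only [zero_add]
  split_ifs <;> simp

variable [IsProbabilityMeasure P]

theorem memLp_stdRow (n : ℕ) (i : Fin n) : MemLp (stdRow P w n i) 2 P :=
  ((hw.memLp_row n i).sub (memLp_const 1)).const_mul _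

/-- The second moment of a linear combination of the standardized weights. -/
theorem integral_sum_mul_stdRow_sq {n : ℕ} (h1 : ∀ i, ∫ ω, stdRow P w n i ω ^ 2 ∂P = 1)
    (α : Fin n → ℝ) :
    ∫ ω, (∑ i, α i * stdRow P w n i ω) ^ 2 ∂P
      = (1 - (weightSd P w n ^ 2)⁻¹ * cov[w n 1, w n 2; P]) * ∑ i, α i ^ 2
        + (weightSd P w n ^ 2)⁻¹ * cov[w n 1, w n 2; P] * (∑ i, α i) ^ 2 :=
  integral_sum_mul_sq (hw.memLp_stdRow n) h1 (fun _ _ hij => hw.integral_stdRow_mul hij) α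

theorem tendsto_integral_mean_sq :
    Tendsto (fun n : ℕ => ∫ ω, ((∑ i, stdRow P w n i ω) / n) ^ 2 ∂P) atTop (𝓝 0) := by
  have hc := hw.tendsto_covariance_stdRow
  have h := ((tendsto_const_nhds (x := (1 : ℝ))).sub hc).mul
    (tendsto_inv_atTop_nhds_zero_nat (𝕜 := ℝ)) |>.add hc
  simp only [mul_zero, add_zero] at h
  refine h.congr' ?_
  filter_upwards [hw.integral_stdRow_sq, eventually_ge_atTop 1] with n h1 hn
  have hn0 : (n : ℝ) ≠ 0 := by positivity
  have := hw.integral_sum_mul_stdRow_sq h1 (fun _ => (n : ℝ)⁻¹)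
  simp_rw [← Finset.mul_sum] at this
  simp only [div_eq_inv_mul]
  rw [this]
  simp
  field_simp

theorem tendsto_integral_abs_mean_sq_sub_one :
    Tendsto (fun n : ℕ => ∫ ω, |(∑ i, stdRow P w n i ω ^ 2) / n - 1| ∂P) atTop (𝓝 0) := by
  have hi : ∀ n : ℕ, Integrable (fun ω => (∑ i, stdRow P w n i ω ^ 2) / n) P := fun n =>
    (integrable_finsetSum _ fun i _ => (hw.memLp_stdRow n i).integrable_sq).div_const _
  refine tendsto_integral_abs_sub_one (M := fun n ω => (∑ i, stdRow P w n i ω ^ 2) / n)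
    (fun n ω => by positivity) hi ?_ ?_
  · filter_upwards [hw.integral_stdRow_sq, eventually_ge_atTop 1] with n h1 hn
    have hn0 : (n : ℝ) ≠ 0 := by positivity
    rw [integral_div, integral_finsetSum _ fun i _ => (hw.memLp_stdRow n i).integrable_sq]
    simp [h1, hn0]
  · refine hw.pw.mean_sq.congr_left fun n => Eventually.of_forall fun ω => ?_
    simp only [sum_Icc_one_eq n fun t => stdWeight P w n t ω ^ 2, stdRow]
    ring

end IsBootstrapWeights

end Weights

/-! ### The bootstrap distribution for a fixed data sequence -/

section FixedData

theorem sum_Icc_two_eq (n : ℕ) (f : ℕ → ℝ) :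
    ∑ t ∈ Finset.Icc 2 n, f t = ∑ i : Fin n, if (i : ℕ) = 0 then 0 else f (i + 1) := by
  have h : ∑ t ∈ Finset.Icc 2 n, f t = ∑ t ∈ Finset.Icc 1 n, if t = 1 then 0 else f t := by
    rw [Finset.sum_ite, Finset.sum_const_zero, zero_add]
    refine Finset.sum_congr ?_ fun _ _ => rfl
    ext t; simp only [Finset.mem_Icc, Finset.mem_filter]; omega
  rw [h, sum_Icc_one_eq]
  simp

/-- The lagged data value `x (t - 1)` belonging to the index `i = t - 1` of a row of weights; it is
set to `0` for `t = 1`, since the sums in the estimators start at `t = 2`. -/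
def lag (x : ℕ → ℝ) (i : ℕ) : ℝ := if i = 0 then 0 else x i

/-- The least squares estimator as a function of the data. -/
noncomputable def lseData (n : ℕ) (x : ℕ → ℝ) : ℝ :=
  (∑ i : Fin n, x (i + 1) * lag x i) / ∑ i : Fin n, lag x i ^ 2

/-- The studentized bootstrap error `√n s⁻¹ (θ* - θ̂)` as a function of the data `x` and of the
weights `u`. -/
noncomputable def bootStat (n : ℕ) (s : ℝ) (x : ℕ → ℝ) (u : Fin n → ℝ) : ℝ :=
  √(n : ℝ) * s⁻¹ * ((∑ i : Fin n, u i * x (i + 1) * lag x i) / (∑ i : Fin n, u i * lag x i ^ 2)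
    - lseData n x)

/-- The least squares scores `n^{-1/2} (x t - θ̂ x (t - 1)) x (t - 1)`. -/
noncomputable def score (n : ℕ) (x : ℕ → ℝ) (i : Fin n) : ℝ :=
  (x (i + 1) - lseData n x * lag x i) * lag x i / √(n : ℝ)

variable {Ω : Type*}

theorem lse_eq_lseData (X : ℕ → Ω → ℝ) (n : ℕ) (ω : Ω) :
    lse X n ω = lseData n fun t => X t ω := by
  rw [lse, lseData, sum_Icc_two_eq, sum_Icc_two_eq]
  congr 1 <;> refine Finset.sum_congr rfl fun i _ => ?_ <;> by_cases h : (i : ℕ) = 0 <;>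
    simp [lag, h]

theorem bootStat_eq (X : ℕ → Ω → ℝ) (w : ℕ → ℕ → Ω → ℝ) (n : ℕ) (s : ℝ) (ω : Ω) :
    √(n : ℝ) * s⁻¹ * (bootLse X w n ω - lse X n ω)
      = bootStat n s (fun t => X t ω) (row w n ω) := by
  rw [bootStat, lse_eq_lseData, bootLse, sum_Icc_two_eq, sum_Icc_two_eq]
  congr 3 <;> refine Finset.sum_congr rfl fun i _ => ?_ <;> by_cases h : (i : ℕ) = 0 <;>
    simp [lag, h, row]

theorem sum_score (n : ℕ) (x : ℕ → ℝ) : ∑ i, score n x i = 0 := by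
  simp only [score, ← Finset.sum_div]
  have h : ∑ i : Fin n, (x (i + 1) - lseData n x * lag x i) * lag x i
      = ∑ i : Fin n, x (i + 1) * lag x i - lseData n x * ∑ i : Fin n, lag x i ^ 2 := by
    rw [Finset.mul_sum, ← Finset.sum_sub_distrib]
    exact Finset.sum_congr rfl fun i _ => by ring
  rw [h]
  by_cases h0 : ∑ i : Fin n, lag x i ^ 2 = 0
  · have hz : ∀ i : Fin n, lag x i = 0 := fun i => by
      have := (Finset.sum_eq_zero_iff_of_nonneg fun i _ => sq_nonneg _).1 h0 i (Finset.mem_univ i)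
      exact pow_eq_zero_iff (two_ne_zero) |>.1 this
    simp [hz]
  · rw [lseData, div_mul_cancel₀ _ h0]; simp

/-- Since the scores sum to zero, the weights enter the bootstrap error only through their
standardized versions `W`. -/
theorem bootStat_eq_sum_score_div {n : ℕ} (hn : n ≠ 0) {s : ℝ} (hs : s ≠ 0) (x : ℕ → ℝ)
    {u W : Fin n → ℝ} (hW : ∀ i, W i = s⁻¹ * (u i - 1))
    (hD : ∑ i : Fin n, u i * lag x i ^ 2 ≠ 0) :
    bootStat n s x u
      = (∑ i, score n x i * W i) * ((∑ i : Fin n, u i * lag x i ^ 2) / n)⁻¹ := by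
  have hn0 : (n : ℝ) ≠ 0 := by exact_mod_cast hn
  have hsn : √(n : ℝ) ≠ 0 := by positivity
  have hz : ∑ i : Fin n, (x (i + 1) - lseData n x * lag x i) * lag x i = 0 := by
    have := sum_score n x
    simp only [score, ← Finset.sum_div, div_eq_zero_iff, hsn, or_false] at this
    exact this
  have h1 : ∑ i : Fin n, u i * x (i + 1) * lag x i
      - lseData n x * ∑ i : Fin n, u i * lag x i ^ 2
      = s * √(n : ℝ) * ∑ i, score n x i * W i := by
    have e1 : s * √(n : ℝ) * ∑ i, score n x i * W i
        = ∑ i : Fin n, (x (i + 1) - lseData n x * lag x i) * lag x i * u i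
          - ∑ i : Fin n, (x (i + 1) - lseData n x * lag x i) * lag x i := by
      rw [Finset.mul_sum, ← Finset.sum_sub_distrib]
      refine Finset.sum_congr rfl fun i _ => ?_
      rw [score, hW]
      field_simp
    rw [e1, hz, sub_zero, Finset.mul_sum, ← Finset.sum_sub_distrib]
    exact Finset.sum_congr rfl fun i _ => by ring
  have h2 : (∑ i : Fin n, u i * x (i + 1) * lag x i) / (∑ i : Fin n, u i * lag x i ^ 2)
      - lseData n x = (s * √(n : ℝ) * ∑ i, score n x i * W i) /
        (∑ i : Fin n, u i * lag x i ^ 2) := by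
    rw [← h1]; field_simp
  rw [bootStat, h2]
  field_simp
  rw [Real.sq_sqrt (by positivity)]
  ring

variable [MeasurableSpace Ω] {P : Measure Ω} [IsProbabilityMeasure P] {X : ℕ → Ω → ℝ}
  {w : ℕ → ℕ → Ω → ℝ}

theorem tendstoInMeasure_of_tendsto_integral_sq {Y : ℕ → Ω → ℝ} {c : ℝ}
    (hY : ∀ k, MemLp (Y k) 2 P)
    (h : Tendsto (fun k => ∫ ω, (Y k ω - c) ^ 2 ∂P) atTop (𝓝 0)) :
    TendstoInMeasure P Y atTop fun _ => c := by
  have hYc : ∀ k, MemLp (Y k - fun _ => c) 2 P := fun k => (hY k).sub (memLp_const c)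
  refine tendstoInMeasure_of_tendsto_eLpNorm (p := 2) (by norm_num) (fun k => (hY k).1)
    aestronglyMeasurable_const ?_
  have he : ∀ k, eLpNorm (Y k - fun _ => c) 2 P
      = ENNReal.ofReal (√(∫ ω, (Y k ω - c) ^ 2 ∂P)) := by
    intro k
    rw [MemLp.eLpNorm_eq_integral_rpow_norm (by norm_num) (by norm_num) (hYc k)]
    simp [Real.sqrt_eq_rpow]
  simp_rw [he]
  simpa using ENNReal.tendsto_ofReal h.sqrt

namespace IsBootstrapWeights

/-- For data with well-behaved second and fourth moments, the weighted mean of squares in the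
denominator of the bootstrap estimator is consistent. -/
theorem tendstoInMeasure_denominator (hw : IsBootstrapWeights P X w) {ns : ℕ → ℕ}
    (hns : Tendsto ns atTop atTop) {x : ℕ → ℝ} {γ : ℝ}
    (h2 : Tendsto (fun k => (∑ i : Fin (ns k), lag x i ^ 2) / ns k) atTop (𝓝 γ))
    (h4 : Tendsto (fun k => weightSd P w (ns k) ^ 2 * (∑ i : Fin (ns k), lag x i ^ 4)
      / (ns k : ℝ) ^ 2) atTop (𝓝 0)) :
    TendstoInMeasure P
      (fun k ω => (∑ i : Fin (ns k), w (ns k) (i + 1) ω * lag x i ^ 2) / ns k) atTop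
      fun _ => γ := by
  have hD : ∀ k, MemLp (fun ω => (∑ i : Fin (ns k), w (ns k) (i + 1) ω * lag x i ^ 2) / ns k) 2 P :=
    fun k => by
      simp_rw [div_eq_mul_inv]
      exact (memLp_finsetSum _ fun i _ => (hw.memLp_row _ i).mul_const _).mul_const _
  refine tendstoInMeasure_of_tendsto_integral_sq hD ?_
  set S2 : ℕ → ℝ := fun k => (∑ i : Fin (ns k), lag x i ^ 2) / ns k with hS2
  set S4 : ℕ → ℝ := fun k => weightSd P w (ns k) ^ 2 * (∑ i : Fin (ns k), lag x i ^ 4)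
      / (ns k : ℝ) ^ 2 with hS4
  set c : ℕ → ℝ := fun k => (weightSd P w (ns k) ^ 2)⁻¹ * cov[w (ns k) 1, w (ns k) 2; P] with hc
  have hc0 : Tendsto c atTop (𝓝 0) := hw.tendsto_covariance_stdRow.comp hns
  have hcov : Tendsto (fun k => cov[w (ns k) 1, w (ns k) 2; P]) atTop (𝓝 0) :=
    (hw.covariance.trans_tendsto tendsto_inv_atTop_nhds_zero_nat).comp hns
  have hlim : Tendsto (fun k => 2 * ((1 - c k) * S4 k
      + cov[w (ns k) 1, w (ns k) 2; P] * S2 k ^ 2) + 2 * (S2 k - γ) ^ 2) atTop (𝓝 0) := by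
    have h := ((((hc0.const_sub 1).mul h4).add (hcov.mul (h2.pow 2))).const_mul 2).add
      (((h2.sub_const γ).pow 2).const_mul 2)
    simpa using h
  refine squeeze_zero' (Eventually.of_forall fun k => integral_nonneg fun _ => sq_nonneg _) ?_ hlim
  filter_upwards [hns.eventually hw.integral_stdRow_sq, hns.eventually hw.weightSd_pos,
    hns.eventually_ge_atTop 1] with k h1 hs hn
  have hn0 : (ns k : ℝ) ≠ 0 := by positivity
  have hvar := hw.integral_sum_mul_stdRow_sq h1 fun i : Fin (ns k) =>
    weightSd P w (ns k) * lag x i ^ 2 / ns k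
  have hWL : MemLp (fun ω => ∑ i : Fin (ns k), (weightSd P w (ns k) * lag x i ^ 2 / ns k)
      * stdRow P w (ns k) i ω) 2 P := memLp_finsetSum _ fun i _ => (hw.memLp_stdRow _ i).const_mul _
  have hpt : ∀ ω, (∑ i : Fin (ns k), w (ns k) (i + 1) ω * lag x i ^ 2) / ns k - γ
      = ∑ i : Fin (ns k), (weightSd P w (ns k) * lag x i ^ 2 / ns k) * stdRow P w (ns k) i ω
        + (S2 k - γ) := by
    intro ω
    simp only [hS2, Finset.sum_div]
    rw [← add_sub_assoc, ← Finset.sum_add_distrib]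
    congr 1
    refine Finset.sum_congr rfl fun i _ => ?_
    rw [stdRow, stdWeight]
    field_simp
    ring
  calc ∫ ω, ((∑ i : Fin (ns k), w (ns k) (i + 1) ω * lag x i ^ 2) / ns k - γ) ^ 2 ∂P
      ≤ ∫ ω, (2 * (∑ i : Fin (ns k), (weightSd P w (ns k) * lag x i ^ 2 / ns k)
          * stdRow P w (ns k) i ω) ^ 2 + 2 * (S2 k - γ) ^ 2) ∂P := by
        refine integral_mono_of_nonneg (Eventually.of_forall fun _ => sq_nonneg _)
          ((hWL.integrable_sq.const_mul 2).add (integrable_const _))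
          (Eventually.of_forall fun ω => ?_)
        simp only [hpt]
        nlinarith [sq_nonneg (∑ i : Fin (ns k), (weightSd P w (ns k) * lag x i ^ 2 / ns k)
          * stdRow P w (ns k) i ω - (S2 k - γ))]
    _ = 2 * ((1 - c k) * S4 k
      + cov[w (ns k) 1, w (ns k) 2; P] * S2 k ^ 2) + 2 * (S2 k - γ) ^ 2 := by
        rw [integral_add (hWL.integrable_sq.const_mul 2) (integrable_const _), integral_const_mul,
          hvar]
        have e1 : ∑ i : Fin (ns k), (weightSd P w (ns k) * lag x i ^ 2 / ns k) ^ 2 = S4 k := by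
          simp only [hS4, Finset.mul_sum, Finset.sum_div]
          exact Finset.sum_congr rfl fun i _ => by ring
        have e2 : ∑ i : Fin (ns k), (weightSd P w (ns k) * lag x i ^ 2 / ns k)
            = weightSd P w (ns k) * S2 k := by
          simp only [hS2, Finset.mul_sum, Finset.sum_div]
          exact Finset.sum_congr rfl fun i _ => by ring
        rw [e1, e2]
        have e3 : cov[w (ns k) 1, w (ns k) 2; P] = c k * weightSd P w (ns k) ^ 2 := by
          simp only [hc]; field_simp
        simp only [integral_const, probReal_univ, smul_eq_mul, one_mul]
        rw [e3]
        have e4 : (weightSd P w (ns k) ^ 2)⁻¹ * (c k * weightSd P w (ns k) ^ 2) = c k := by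
          field_simp
        rw [e4]
        ring

/-- Conditional central limit theorem: for a fixed data sequence with the stated limits of its
empirical moments, the distribution functions of the bootstrap error converge to a Gaussian one. -/
theorem tendsto_bootStat_law (hw : IsBootstrapWeights P X w) {ns : ℕ → ℕ}
    (hns : Tendsto ns atTop atTop) {x : ℕ → ℝ} {γ τ : ℝ} (hγ : 0 < γ) (hτ : 0 < τ)
    (h2 : Tendsto (fun k => (∑ i : Fin (ns k), lag x i ^ 2) / ns k) atTop (𝓝 γ))
    (h4 : Tendsto (fun k => weightSd P w (ns k) ^ 2 * (∑ i : Fin (ns k), lag x i ^ 4)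
      / (ns k : ℝ) ^ 2) atTop (𝓝 0))
    (hb2 : Tendsto (fun k => ∑ i, score (ns k) x i ^ 2) atTop (𝓝 τ))
    (hb4 : Tendsto (fun k => ∑ i, score (ns k) x i ^ 4) atTop (𝓝 0)) (y : ℝ) :
    Tendsto (fun k => P.real {ω | bootStat (ns k) (weightSd P w (ns k)) x (row w (ns k) ω) ≤ y})
      atTop (𝓝 ((gaussianReal 0 (τ / γ ^ 2).toNNReal).real (Set.Iic y))) := by
  set V : ℕ → Ω → ℝ := fun k ω => ∑ i, score (ns k) x i * stdRow P w (ns k) i ω with hV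
  set D : ℕ → Ω → ℝ := fun k ω => (∑ i : Fin (ns k), w (ns k) (i + 1) ω * lag x i ^ 2) / ns k
    with hD
  set S : ℕ → Ω → ℝ := fun k ω => bootStat (ns k) (weightSd P w (ns k)) x (row w (ns k) ω) with hS
  have hVm : ∀ k, Measurable (V k) := fun k =>
    Finset.measurable_sum _ fun i _ => (hw.measurable_stdRow _ i).const_mul _
  have hDm : ∀ k, Measurable (D k) := fun k =>
    (Finset.measurable_sum _ fun i _ => (hw.measurable_row _ i).mul_const _).div_const _
  have hSm : ∀ k, Measurable (S k) := fun k =>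
    (((Finset.measurable_sum _ fun i _ => ((hw.measurable_row _ i).mul_const _).mul_const _).div
      (Finset.measurable_sum _ fun i _ => (hw.measurable_row _ i).mul_const _)).sub_const
        _).const_mul _
  have hDγ : TendstoInMeasure P D atTop fun _ => γ := hw.tendstoInMeasure_denominator hns h2 h4
  -- the numerator
  have hVlaw : TendstoInDistribution V atTop id (fun _ => P) (gaussianReal 0 τ.toNNReal) := by
    refine ⟨fun k => (hVm k).aemeasurable, aemeasurable_id, ?_⟩
    refine ProbabilityMeasure.tendsto_of_tendsto_charFun fun r => ?_
    have hlim := tendsto_charFun_of_exchangeable (P := P) hns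
      (W := fun k => stdRow P w (ns k)) (b := fun k => score (ns k) x) hτ.le
      (Eventually.of_forall fun k => hw.exchangeable_stdRow _)
      (Eventually.of_forall fun k => hw.memLp_stdRow _)
      (hns.eventually hw.integral_stdRow_sq)
      (hw.tendsto_integral_mean_sq.comp hns) (hw.tendsto_integral_abs_mean_sq_sub_one.comp hns)
      (fun T hT => by
        obtain ⟨K, hK, h⟩ := hw.exists_integral_tailSq_le T hT
        exact ⟨K, hK, hns.eventually h⟩)
      (Eventually.of_forall fun k => sum_score _ _) hb2 hb4 r
    have e1 : charFun (gaussianReal 0 τ.toNNReal) r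
        = ((Real.exp (-(r ^ 2 * τ / 2)) : ℝ) : ℂ) := by
      rw [charFun_gaussianReal]
      push_cast
      congr 1
      rw [Real.coe_toNNReal _ hτ.le]
      ring
    have e2 : ∀ k, charFun (P.map (V k)) r
        = ∫ ω, Complex.exp ((r * V k ω : ℝ) * Complex.I) ∂P := by
      intro k
      rw [charFun_apply_real, integral_map (hVm k).aemeasurable (by fun_prop)]
      push_cast; rfl
    simp only [ProbabilityMeasure.coe_mk, Measure.map_id, e1, e2]
    exact hlim
  have hDinv : TendstoInMeasure P (fun k ω => (D k ω)⁻¹) atTop fun _ => γ⁻¹ := by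
    refine (exists_seq_tendstoInMeasure_atTop_iff (f := fun k ω => (D k ω)⁻¹)
      fun k => (hDm k).inv.aestronglyMeasurable).2 ?_
    intro ms hms
    obtain ⟨ms', hms', h⟩ := (exists_seq_tendstoInMeasure_atTop_iff
      fun k => (hDm k).aestronglyMeasurable).1 hDγ ms hms
    refine ⟨ms', hms', ?_⟩
    filter_upwards [h] with ω hω using hω.inv₀ hγ.ne'
  have hprod := hVlaw.continuous_comp_prodMk_of_tendstoInMeasure_const
    (g := fun p : ℝ × ℝ => p.1 * p.2) (by fun_prop) hDinv fun k => (hDm k).inv.aemeasurable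
  -- the quotient representation fails only where the denominator vanishes
  have hdiff : TendstoInMeasure P (S - fun k ω => V k ω * (D k ω)⁻¹) atTop 0 := by
    rw [tendstoInMeasure_iff_norm]
    intro ε hε
    have hz := tendstoInMeasure_iff_norm.1 hDγ γ hγ
    refine tendsto_of_tendsto_of_tendsto_of_le_of_le' tendsto_const_nhds hz
      (Eventually.of_forall fun _ => zero_le) ?_
    filter_upwards [hns.eventually hw.weightSd_pos, hns.eventually_ge_atTop 1] with k hs hn
    refine measure_mono fun ω hω => ?_
    simp only [Set.mem_ofPred_eq, Pi.sub_apply, Pi.zero_apply, sub_zero] at hω ⊢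
    by_contra hcon
    have hD0 : D k ω ≠ 0 := by
      intro h0
      apply hcon
      rw [h0, zero_sub, norm_neg, Real.norm_of_nonneg hγ.le]
    have hD1 : ∑ i : Fin (ns k), row w (ns k) ω i * lag x i ^ 2 ≠ 0 := by
      intro h0
      exact hD0 (by simp only [hD]; simp only [row] at h0; rw [h0, zero_div])
    have := bootStat_eq_sum_score_div (by omega) hs.ne' x (u := row w (ns k) ω)
      (W := fun i => stdRow P w (ns k) i ω) (fun i => rfl) hD1
    simp only [hS, this] at hω
    simp only [hV, hD, row, sub_self, norm_zero] at hω
    linarith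
  have hSlaw := tendstoInDistribution_of_tendstoInMeasure_sub _ _ hprod hdiff
    fun k => (hSm k).aemeasurable
  have hmap : (gaussianReal 0 τ.toNNReal).map (fun ω : ℝ => id ω * γ⁻¹)
      = gaussianReal 0 (τ / γ ^ 2).toNNReal := by
    simp only [id]
    rw [gaussianReal_map_mul_const]
    congr 1
    · simp
    · ext
      rw [NNReal.coe_mul, Real.coe_toNNReal _ hτ.le, Real.coe_toNNReal _ (by positivity)]
      simp; field_simp
  have hv : (τ / γ ^ 2).toNNReal ≠ 0 := by
    simp only [ne_eq, Real.toNNReal_eq_zero, not_le]; positivity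
  have := nullSingletonClass_gaussianReal (μ := 0) hv
  have hport := ProbabilityMeasure.tendsto_measure_of_null_frontier_of_tendsto' hSlaw.tendsto
    (E := Set.Iic y) (by
      simp only [ProbabilityMeasure.coe_mk, hmap]
      rw [frontier_Iic]
      exact measure_singleton y)
  simp only [ProbabilityMeasure.coe_mk, hmap] at hport
  have hreal := (ENNReal.tendsto_toReal (measure_ne_top _ _)).comp hport
  refine hreal.congr fun k => ?_
  simp only [Function.comp_def]
  rw [Measure.map_apply (hSm k) measurableSet_Iic]
  rfl

end IsBootstrapWeights

end FixedData

/-! ### Causality and moments of the stationary AR(1) process -/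

section Autoregression

/-- The AR(1) recursion with innovations `z` started at zero. -/
def arSum (θ : ℝ) (z : ℕ → ℝ) : ℕ → ℝ
  | 0 => 0
  | m + 1 => θ * arSum θ z m + z m

theorem arSum_congr {θ : ℝ} {z z' : ℕ → ℝ} {m : ℕ} (h : ∀ i < m, z i = z' i) :
    arSum θ z m = arSum θ z' m := by
  induction m with
  | zero => rfl
  | succ m ih =>
    rw [arSum, arSum, ih fun i hi => h i (by omega), h m (by omega)]

@[fun_prop]
theorem measurable_arSum (θ : ℝ) (m : ℕ) : Measurable fun z : ℕ → ℝ => arSum θ z m := by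
  induction m with
  | zero => exact measurable_const
  | succ m ih => exact (ih.const_mul θ).add (measurable_pi_apply m)

variable {Ω : Type*} [MeasurableSpace Ω] {P : Measure Ω} {X Z : ℕ → Ω → ℝ} {θ σ : ℝ}

namespace IsStationaryAR1

variable (hX : IsStationaryAR1 P X Z θ σ)
include hX

theorem ae_recursion : ∀ᵐ ω ∂P, ∀ t, X (t + 1) ω = θ * X t ω + Z (t + 1) ω :=
  ae_all_iff.2 fun t => by simpa using hX.recursion (t + 1) (by omega)

theorem ae_eq_arSum :
    ∀ᵐ ω ∂P, ∀ m, X m ω = θ ^ m * X 0 ω + arSum θ (fun i => Z (i + 1) ω) m := by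
  filter_upwards [hX.ae_recursion] with ω hω m
  induction m with
  | zero => simp [arSum]
  | succ m ih => rw [hω, ih, arSum]; ring

theorem measurable_arSum_comp (m : ℕ) :
    Measurable fun ω => arSum θ (fun i => Z (i + 1) ω) m :=
  (measurable_arSum θ m).comp (measurable_pi_lambda _ fun i => hX.measurable_Z (i + 1))

theorem identDistrib_X (t : ℕ) : IdentDistrib (X t) (X 0) P P := by
  have h := (hX.stationary t).comp (measurable_pi_apply 0)
  simpa [Function.comp_def] using h

theorem identDistrib_Z (t : ℕ) : IdentDistrib (Z (t + 1)) (Z 1) P P :=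
  hX.identDistrib (t + 1) (by omega)

/-- Finitely many values of the recursion started at zero do not depend on later innovations. -/
theorem indepFun_arSum (t k : ℕ) :
    IndepFun (fun ω (j : Fin (t + 1)) => arSum θ (fun i => Z (i + 1) ω) (j + k))
      (Z (t + k + 1)) P := by
  have h := hX.indep.indepFun_finset (Finset.range (t + k)) {t + k}
    (by simp) fun i => hX.measurable_Z (i + 1)
  have hψ : Measurable fun v : ({t + k} : Finset ℕ) → ℝ => v ⟨t + k, by simp⟩ :=
    measurable_pi_apply _
  have hφ : Measurable fun (v : Finset.range (t + k) → ℝ) (j : Fin (t + 1)) =>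
      arSum θ (fun i => if hi : i ∈ Finset.range (t + k) then v ⟨i, hi⟩ else 0) (j + k) := by
    refine measurable_pi_lambda _ fun j => (measurable_arSum θ _).comp
      (measurable_pi_lambda _ fun i => ?_)
    by_cases hi : i ∈ Finset.range (t + k)
    · simp only [hi, dite_true]; exact measurable_pi_apply _
    · simp only [hi, dite_false]; exact measurable_const
  convert! h.comp hφ hψ using 1
  funext ω j
  simp only [Function.comp_def]
  refine arSum_congr fun i hi => ?_
  have : i ∈ Finset.range (t + k) := Finset.mem_range.2 (by omega)
  simp [this]

/-- Uniform bound of the fourth moments by a geometric series. -/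
theorem eLpNorm_arSum_le : ∃ c : ℝ≥0∞, c ≠ ∞ ∧
    ∀ m, eLpNorm (fun ω => arSum θ (fun i => Z (i + 1) ω) m) 4 P ≤ c := by
  set z : ℝ := (eLpNorm (Z 1) 4 P).toReal with hz
  have hzt : eLpNorm (Z 1) 4 P = ENNReal.ofReal z :=
    (ENNReal.ofReal_toReal hX.fourth_moment.eLpNorm_ne_top).symm
  have hz0 : 0 ≤ z := ENNReal.toReal_nonneg
  have h1 : 0 < 1 - |θ| := by linarith [hX.abs_theta_lt_one]
  refine ⟨ENNReal.ofReal (z / (1 - |θ|)), ENNReal.ofReal_ne_top, fun m => ?_⟩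
  induction m with
  | zero => simp [arSum]
  | succ m ih =>
    have hm := hX.measurable_arSum_comp m
    have hZ : eLpNorm (Z (m + 1)) 4 P = ENNReal.ofReal z := by
      rw [← hzt]; exact (hX.identDistrib_Z m).eLpNorm_eq 4
    have hadd := eLpNorm_add_le (p := 4) (μ := P)
      (f := θ • fun ω => arSum θ (fun i => Z (i + 1) ω) m) (g := Z (m + 1))
      (hm.const_smul θ).aestronglyMeasurable (hX.measurable_Z _).aestronglyMeasurable
      (by norm_num)
    calc _ ≤ _ := hadd
      _ ≤ ENNReal.ofReal |θ| * ENNReal.ofReal (z / (1 - |θ|)) + ENNReal.ofReal z := by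
        rw [eLpNorm_const_smul, hZ, Real.enorm_eq_ofReal_abs]
        gcongr
      _ = ENNReal.ofReal (z / (1 - |θ|)) := by
        rw [← ENNReal.ofReal_mul (abs_nonneg _), ← ENNReal.ofReal_add (by positivity) hz0]
        congr 1
        field_simp; ring

variable [IsProbabilityMeasure P]

/-- Since `θ ^ k → 0`, the stationary law is the limit law of the recursion started at zero, also
jointly with the following innovation. -/
theorem tendstoInDistribution_arSum (t : ℕ) :
    TendstoInDistribution (fun k ω =>
        ((fun j : Fin (t + 1) => arSum θ (fun i => Z (i + 1) ω) (j + k)),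
          X (t + 1 + k) ω - θ * X (t + k) ω)) atTop
      (fun ω => ((fun j : Fin (t + 1) => X j ω), X (t + 1) ω - θ * X t ω)) (fun _ => P) P := by
  have hΦ : Measurable fun x : ℕ → ℝ =>
      ((fun j : Fin (t + 1) => x j), x (t + 1) - θ * x t) := by fun_prop
  have hid : ∀ k, IdentDistrib
      (fun ω => ((fun j : Fin (t + 1) => X (j + k) ω), X (t + 1 + k) ω - θ * X (t + k) ω))
      (fun ω => ((fun j : Fin (t + 1) => X j ω), X (t + 1) ω - θ * X t ω)) P P := fun k =>
    (hX.stationary k).comp hΦ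
  have hbase := tendstoInDistribution_of_identDistrib (μ := fun _ : ℕ => P) (l := atTop)
    (X := fun k ω => ((fun j : Fin (t + 1) => X (j + k) ω), X (t + 1 + k) ω - θ * X (t + k) ω)) 0
    (fun k => (hid 0).trans (hid k).symm) (hid 0)
  have hm := hX.measurable_X
  have hm' := hX.measurable_arSum_comp
  refine tendstoInDistribution_of_tendstoInMeasure_sub _ _ hbase ?_ fun k => ?_
  · refine tendstoInMeasure_of_tendsto_ae (fun k => ?_) ?_
    · simp only [Pi.sub_def]
      exact Measurable.aestronglyMeasurable (by fun_prop)
    · filter_upwards [hX.ae_eq_arSum] with ω hω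
      have h0 : Tendsto (fun k : ℕ => θ ^ k) atTop (𝓝 0) :=
        tendsto_pow_atTop_nhds_zero_of_abs_lt_one hX.abs_theta_lt_one
      simp only [Pi.sub_apply, Pi.zero_apply, Prod.mk_sub_mk, sub_self]
      refine Tendsto.prodMk_nhds ?_ tendsto_const_nhds
      rw [tendsto_pi_nhds]
      intro j
      have h1 : Tendsto (fun k : ℕ => -(θ ^ (j : ℕ) * θ ^ k * X 0 ω)) atTop
          (𝓝 (-(θ ^ (j : ℕ) * 0 * X 0 ω))) := ((h0.const_mul _).mul_const _).neg
      simp only [mul_zero, zero_mul, neg_zero] at h1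
      refine h1.congr fun k => ?_
      rw [Pi.sub_apply, hω (j + k), pow_add]; ring
  · exact Measurable.aemeasurable (by fun_prop)

/-- Causality: the innovations are independent of the past of the process. -/
theorem indepFun_past (t : ℕ) :
    IndepFun (fun ω (j : Fin (t + 1)) => X j ω) (Z (t + 1)) P := by
  have hm := hX.measurable_X
  have hm' := hX.measurable_arSum_comp
  have hinn : ∀ k, (fun ω => X (t + 1 + k) ω - θ * X (t + k) ω) =ᵐ[P] Z (t + k + 1) := fun k => by
    filter_upwards [hX.ae_recursion] with ω hω
    rw [show t + 1 + k = t + k + 1 by ring, hω]; ring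
  suffices h : IndepFun (fun ω (j : Fin (t + 1)) => X j ω)
      (fun ω => X (t + 1) ω - θ * X t ω) P from h.congr EventuallyEq.rfl (hinn 0)
  refine indepFun_of_bcf (by fun_prop) (by fun_prop) fun f g => ?_
  have hlim := ProbabilityMeasure.tendsto_iff_forall_integral_tendsto.1
    (hX.tendstoInDistribution_arSum t).tendsto
  have hmk : ∀ k, AEMeasurable (fun ω =>
      ((fun j : Fin (t + 1) => arSum θ (fun i => Z (i + 1) ω) (j + k)),
          X (t + 1 + k) ω - θ * X (t + k) ω)) P := fun k =>
    Measurable.aemeasurable (by fun_prop)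
  have hm0 : AEMeasurable (fun ω =>
      ((fun j : Fin (t + 1) => X j ω), X (t + 1) ω - θ * X t ω)) P :=
    Measurable.aemeasurable (by fun_prop)
  have hmap : ∀ F : BoundedContinuousFunction ((Fin (t + 1) → ℝ) × ℝ) ℝ,
      Tendsto (fun k => ∫ ω, F ((fun j : Fin (t + 1) => arSum θ (fun i => Z (i + 1) ω) (j + k)),
          X (t + 1 + k) ω - θ * X (t + k) ω) ∂P) atTop
        (𝓝 (∫ ω, F ((fun j : Fin (t + 1) => X j ω), X (t + 1) ω - θ * X t ω) ∂P)) := by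
    intro F
    have h := hlim F
    simp only [ProbabilityMeasure.coe_mk] at h
    rw [integral_map hm0 (by fun_prop)] at h
    refine h.congr fun k => ?_
    rw [integral_map (hmk k) (by fun_prop)]
  have h1 := hmap ((f.compContinuous ⟨Prod.fst, continuous_fst⟩) *
    (g.compContinuous ⟨Prod.snd, continuous_snd⟩))
  have h2 := (hmap (f.compContinuous ⟨Prod.fst, continuous_fst⟩)).mul
    (hmap (g.compContinuous ⟨Prod.snd, continuous_snd⟩))
  simp only [BoundedContinuousFunction.coe_mul, Pi.mul_apply,
    BoundedContinuousFunction.compContinuous_apply, ContinuousMap.coe_mk] at h1 h2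
  refine tendsto_nhds_unique h1 (h2.congr fun k => ?_)
  have hind := ((hX.indepFun_arSum t k).congr EventuallyEq.rfl (hinn k).symm).comp
    f.continuous.measurable g.continuous.measurable
  refine (IndepFun.integral_fun_mul_eq_mul_integral hind ?_ ?_).symm
  · exact (f.continuous.measurable.comp (by fun_prop)).aestronglyMeasurable
  · exact (g.continuous.measurable.comp (by fun_prop)).aestronglyMeasurable

theorem indepFun_X_Z (t : ℕ) : IndepFun (X t) (Z (t + 1)) P := by
  have hφ : Measurable fun v : Fin (t + 1) → ℝ => v ⟨t, by omega⟩ := measurable_pi_apply _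
  have h := (hX.indepFun_past t).comp hφ measurable_id
  simpa [Function.comp_def] using h

/-- The stationary law has a finite fourth moment, by Fatou's lemma for weak convergence. -/
theorem memLp_X_zero : MemLp (X 0) 4 P := by
  obtain ⟨c, hc, hS⟩ := hX.eLpNorm_arSum_le
  have h4 : ∀ U : Ω → ℝ, eLpNorm U 4 P ^ 4 = ∫⁻ ω, ENNReal.ofReal (U ω ^ 4) ∂P := by
    intro U
    rw [eLpNorm_eq_lintegral_rpow_enorm_toReal (by norm_num) (by norm_num),
      ← ENNReal.rpow_natCast, ← ENNReal.rpow_mul]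
    norm_num
    refine lintegral_congr fun ω => ?_
    rw [Real.enorm_eq_ofReal_abs, ← ENNReal.ofReal_pow (abs_nonneg _)]
    congr 1
    exact (Even.pow_abs (by decide) _)
  have hconv : TendstoInDistribution (fun k ω => arSum θ (fun i => Z (i + 1) ω) k) atTop
      (X 0) (fun _ => P) P := by
    have h := (hX.tendstoInDistribution_arSum 0).continuous_comp
      (g := fun p : (Fin (0 + 1) → ℝ) × ℝ => p.1 0) (by fun_prop)
    simpa [Function.comp_def] using h
  have hfatou := lintegral_le_liminf_lintegral_of_forall_isOpen_measure_le_liminf_measure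
    (μ := P.map (X 0)) (μs := fun k => P.map fun ω => arSum θ (fun i => Z (i + 1) ω) k)
    (f := fun x : ℝ => x ^ 4) (by fun_prop) (fun x => by positivity)
    (fun G hG => by
      simpa using ProbabilityMeasure.le_liminf_measure_open_of_tendsto hconv.tendsto hG)
  rw [lintegral_map (by fun_prop) (hX.measurable_X 0), ← h4] at hfatou
  refine ⟨(hX.measurable_X 0).aestronglyMeasurable, ?_⟩
  have hle : eLpNorm (X 0) 4 P ^ 4 ≤ c ^ 4 := by
    refine hfatou.trans (liminf_le_of_le (by isBoundedDefault) fun b hb => ?_)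
    obtain ⟨k, hk⟩ := hb.exists
    refine hk.trans ?_
    rw [lintegral_map (by fun_prop) (hX.measurable_arSum_comp k), ← h4]
    gcongr
    exact hS k
  have : eLpNorm (X 0) 4 P ^ 4 < ∞ := hle.trans_lt (ENNReal.pow_lt_top (lt_top_iff_ne_top.2 hc))
  exact (ENNReal.pow_lt_top_iff.1 this).resolve_right (by norm_num)

theorem memLp_mul_innovation {G H : ℝ → ℝ} (hG : Measurable G) (hH : Measurable H)
    (hG2 : MemLp (fun ω => G (X 0 ω)) 2 P) (hH2 : MemLp (fun ω => H (Z 1 ω)) 2 P) (t : ℕ) :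
    MemLp (fun ω => G (X t ω) * H (Z (t + 1) ω)) 2 P ∧
      ∫ ω, (G (X t ω) * H (Z (t + 1) ω)) ^ 2 ∂P
        = (∫ ω, G (X 0 ω) ^ 2 ∂P) * ∫ ω, H (Z 1 ω) ^ 2 ∂P := by
  have hmX := hX.measurable_X t
  have hmZ := hX.measurable_Z (t + 1)
  have hGt : MemLp (fun ω => G (X t ω)) 2 P :=
    ((hX.identDistrib_X t).comp hG).memLp_iff.2 hG2
  have hHt : MemLp (fun ω => H (Z (t + 1) ω)) 2 P :=
    ((hX.identDistrib_Z t).comp hH).memLp_iff.2 hH2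
  have hind : IndepFun (fun ω => G (X t ω) ^ 2) (fun ω => H (Z (t + 1) ω) ^ 2) P :=
    (hX.indepFun_X_Z t).comp (φ := fun x => G x ^ 2) (ψ := fun x => H x ^ 2)
      (by fun_prop) (by fun_prop)
  constructor
  · rw [memLp_two_iff_integrable_sq (by fun_prop)]
    simp_rw [mul_pow]
    exact hind.integrable_mul hGt.integrable_sq hHt.integrable_sq
  · simp_rw [mul_pow]
    rw [hind.integral_fun_mul_eq_mul_integral hGt.integrable_sq.1 hHt.integrable_sq.1]
    congr 1
    · exact ((hX.identDistrib_X t).comp (u := fun x => G x ^ 2) (by fun_prop)).integral_eq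
    · exact ((hX.identDistrib_Z t).comp (u := fun x => H x ^ 2) (by fun_prop)).integral_eq

/-- If `H (Z 1)` is centered, the variables `G (X t) H (Z (t + 1))` are uncorrelated: the innovation
with the larger index is independent of all other factors. No integrability is needed, since the
integral of a product of independent variables factors also with the value `0` for divergent
integrals. -/
theorem integral_mul_innovation_eq_zero {G H : ℝ → ℝ} (hG : Measurable G) (hH : Measurable H)
    (hH0 : ∫ ω, H (Z 1 ω) ∂P = 0) {s t : ℕ} (hst : s < t) :
    ∫ ω, (G (X s ω) * H (Z (s + 1) ω)) * (G (X t ω) * H (Z (t + 1) ω)) ∂P = 0 := by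
  have hm := hX.measurable_X
  have hmZ := hX.measurable_Z (t + 1)
  have hind := (hX.indepFun_past t).comp
    (φ := fun v : Fin (t + 1) → ℝ => G (v ⟨s, by omega⟩) *
      H (v ⟨s + 1, by omega⟩ - θ * v ⟨s, by omega⟩) * G (v ⟨t, by omega⟩))
    (ψ := H) (by fun_prop) hH
  have h := hind.integral_fun_mul_eq_mul_integral
    (by simp only [Function.comp_def]; exact Measurable.aestronglyMeasurable (by fun_prop))
    (by simp only [Function.comp_def]; exact Measurable.aestronglyMeasurable (by fun_prop))
  simp only [Function.comp_def] at h
  have hz : ∫ ω, H (Z (t + 1) ω) ∂P = 0 := by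
    rw [← hH0]; exact ((hX.identDistrib_Z t).comp hH).integral_eq
  rw [hz, mul_zero] at h
  rw [← h]
  refine integral_congr_ae ?_
  filter_upwards [hX.ae_recursion] with ω hω
  rw [hω s]
  ring_nf

/-- The second moment of sums of `G (X t) H (Z (t + 1))` grows linearly. -/
theorem integral_sum_mul_innovation_sq {G H : ℝ → ℝ} (hG : Measurable G) (hH : Measurable H)
    (hG2 : MemLp (fun ω => G (X 0 ω)) 2 P) (hH2 : MemLp (fun ω => H (Z 1 ω)) 2 P)
    (hH0 : ∫ ω, H (Z 1 ω) ∂P = 0) (n : ℕ) (α : Fin n → ℝ) :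
    ∫ ω, (∑ i : Fin n, α i * (G (X i ω) * H (Z (i + 1) ω))) ^ 2 ∂P
      = ((∫ ω, G (X 0 ω) ^ 2 ∂P) * ∫ ω, H (Z 1 ω) ^ 2 ∂P) * ∑ i, α i ^ 2 := by
  have h := integral_sum_mul_sq (P := P) (Y := fun (i : Fin n) ω => G (X i ω) * H (Z (i + 1) ω))
    (c := 0) (fun i => (hX.memLp_mul_innovation hG hH hG2 hH2 i).1)
    (fun i => (hX.memLp_mul_innovation hG hH hG2 hH2 i).2) (fun i j hij => ?_) α
  · simpa using h
  · rcases lt_or_gt_of_ne (fun h => hij (Fin.ext h) : (i : ℕ) ≠ j) with hlt | hlt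
    · exact hX.integral_mul_innovation_eq_zero hG hH hH0 hlt
    · rw [← hX.integral_mul_innovation_eq_zero hG hH hH0 hlt]
      exact integral_congr_ae (Eventually.of_forall fun ω => mul_comm _ _)

end IsStationaryAR1

end Autoregression

/-! ### Data sequences of an AR(1) process with small empirical errors -/

section Data

/-- The sum of the deviations from their limits of the empirical moments of the data `x` and of
the innovations `z i = x (i + 1) - θ x i`, weighted so that it has small mean for an AR(1)
process. The factor `√n` in the first summand and its inverse in the fourth one cancel in the
product of the two, which controls the effect of estimating `θ` in the scores. -/
noncomputable def dataError (n : ℕ) (s σ : ℝ) (x z : ℕ → ℝ) : ℝ :=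
  √(n : ℝ) * ((∑ i : Fin n, lag x i * z i) / n) ^ 2
    + ((∑ i : Fin n, lag x i ^ 2 * (z i ^ 2 - σ ^ 2)) / n) ^ 2
    + ((∑ i : Fin n, if (i : ℕ) = 0 then 0 else z i ^ 2 - σ ^ 2) / n) ^ 2
    + (√(n : ℝ))⁻¹ * ((∑ i : Fin n, lag x i ^ 4) / n)
    + s ^ 2 * (∑ i : Fin n, lag x i ^ 4) / (n : ℝ) ^ 2
    + (∑ i : Fin n, lag x i ^ 4 * z i ^ 4) / (n : ℝ) ^ 2
    + (x 1 ^ 2 + x n ^ 2) / n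

theorem tendsto_zero_of_sq {f : ℕ → ℝ} (h : Tendsto (fun k => f k ^ 2) atTop (𝓝 0)) :
    Tendsto f atTop (𝓝 0) := by
  have := h.sqrt
  simp only [Real.sqrt_sq_eq_abs, Real.sqrt_zero] at this
  exact (tendsto_zero_iff_abs_tendsto_zero f).2 this

theorem lag_mul_self (x : ℕ → ℝ) (i : ℕ) : lag x i * x i = lag x i ^ 2 := by
  unfold lag; split_ifs <;> ring

/-- Squaring the recursion and summing yields the empirical second moment. -/
theorem sum_lag_sq_eq {θ σ : ℝ} {x z : ℕ → ℝ} (hx : ∀ i, x (i + 1) = θ * x i + z i) {n : ℕ}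
    (hn : 1 ≤ n) :
    (1 - θ ^ 2) * ∑ i : Fin n, lag x i ^ 2
      = 2 * θ * (∑ i : Fin n, lag x i * z i)
        + (∑ i : Fin n, if (i : ℕ) = 0 then 0 else z i ^ 2 - σ ^ 2)
        + σ ^ 2 * (n - 1) - (x n ^ 2 - x 1 ^ 2) := by
  rw [Fin.sum_univ_eq_sum_range (fun i => lag x i ^ 2),
    Fin.sum_univ_eq_sum_range (fun i => lag x i * z i),
    Fin.sum_univ_eq_sum_range (fun i => if i = 0 then 0 else z i ^ 2 - σ ^ 2)]
  induction n, hn using Nat.le_induction with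
  | base => simp [lag]
  | succ n hn ih =>
    rw [Finset.sum_range_succ, Finset.sum_range_succ, Finset.sum_range_succ, mul_add, ih]
    have h0 : n ≠ 0 := by omega
    simp only [lag, h0, if_false, hx n]
    push_cast
    ring

/-- The scores in terms of the innovations; the subtracted term is the error made by replacing
`θ` by its estimate. -/
theorem score_eq {θ : ℝ} {x z : ℕ → ℝ} (hx : ∀ i, x (i + 1) = θ * x i + z i) {n : ℕ}
    (h0 : ∑ i : Fin n, lag x i ^ 2 ≠ 0) (i : Fin n) :
    score n x i = (lag x i * z i - (∑ i : Fin n, lag x i * z i) / (∑ i : Fin n, lag x i ^ 2)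
      * lag x i ^ 2) / √(n : ℝ) := by
  have h1 : lseData n x
      = θ + (∑ i : Fin n, lag x i * z i) / (∑ i : Fin n, lag x i ^ 2) := by
    have : ∑ i : Fin n, x (i + 1) * lag x i
        = θ * ∑ i : Fin n, lag x i ^ 2 + ∑ i : Fin n, lag x i * z i := by
      rw [Finset.mul_sum, ← Finset.sum_add_distrib]
      refine Finset.sum_congr rfl fun i _ => ?_
      rw [← lag_mul_self, hx]; ring
    rw [lseData, this]
    field_simp
  rw [score, h1, hx]
  congr 1
  linear_combination θ * lag_mul_self x i

theorem sum_score_sq {θ : ℝ} {x z : ℕ → ℝ} (hx : ∀ i, x (i + 1) = θ * x i + z i) {n : ℕ}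
    (h0 : ∑ i : Fin n, lag x i ^ 2 ≠ 0) {δ : ℝ}
    (hδ : δ = (∑ i : Fin n, lag x i * z i) / (∑ i : Fin n, lag x i ^ 2)) :
    |∑ i, score n x i ^ 2 - (∑ i : Fin n, (lag x i * z i) ^ 2) / n|
      ≤ 2 * √((∑ i : Fin n, (lag x i * z i) ^ 2) / n *
          (δ ^ 2 * ((∑ i : Fin n, lag x i ^ 4) / n)))
        + δ ^ 2 * ((∑ i : Fin n, lag x i ^ 4) / n) := by
  set Q := ∑ i : Fin n, (lag x i * z i) ^ 2 with hQ
  set A := ∑ i : Fin n, lag x i ^ 4 with hA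
  set C := ∑ i : Fin n, (lag x i * z i) * lag x i ^ 2 with hC
  have hQ0 : 0 ≤ Q := Finset.sum_nonneg fun i _ => sq_nonneg _
  have hA0 : 0 ≤ A := Finset.sum_nonneg fun i _ => by positivity
  have hCS : C ^ 2 ≤ Q * A := by
    have := Finset.sum_mul_sq_le_sq_mul_sq Finset.univ (fun i : Fin n => lag x i * z i)
      (fun i : Fin n => lag x i ^ 2)
    simpa only [← pow_mul] using this
  have hs : ∑ i, score n x i ^ 2 - Q / n = -(2 * (δ * C / n)) + δ ^ 2 * (A / n) := by
    have : ∀ i : Fin n, score n x i ^ 2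
        = (lag x i * z i) ^ 2 / n - 2 * δ / n * ((lag x i * z i) * lag x i ^ 2)
          + δ ^ 2 / n * lag x i ^ 4 := fun i => by
      rw [score_eq hx h0, ← hδ, div_pow, Real.sq_sqrt (by positivity)]; ring
    simp only [this, Finset.sum_add_distrib, Finset.sum_sub_distrib, ← Finset.mul_sum,
      ← Finset.sum_div]
    ring
  have hb : |δ * C / n| ≤ √(Q / n * (δ ^ 2 * (A / n))) := by
    apply Real.abs_le_sqrt
    calc (δ * C / n) ^ 2 = δ ^ 2 * C ^ 2 / (n : ℝ) ^ 2 := by ring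
      _ ≤ δ ^ 2 * (Q * A) / (n : ℝ) ^ 2 := by gcongr
      _ = _ := by ring
  rw [hs]
  have hp : 0 ≤ δ ^ 2 * (A / n) := by positivity
  have := abs_le.1 hb
  rw [abs_le]
  constructor <;> linarith

theorem sum_score_pow_four_le {θ : ℝ} {x z : ℕ → ℝ} (hx : ∀ i, x (i + 1) = θ * x i + z i)
    {n : ℕ} (h0 : ∑ i : Fin n, lag x i ^ 2 ≠ 0) {δ : ℝ}
    (hδ : δ = (∑ i : Fin n, lag x i * z i) / (∑ i : Fin n, lag x i ^ 2)) :
    ∑ i, score n x i ^ 4 ≤ 8 * ((∑ i : Fin n, lag x i ^ 4 * z i ^ 4) / (n : ℝ) ^ 2)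
      + 8 * (δ ^ 2 * ((∑ i : Fin n, lag x i ^ 4) / n)) ^ 2 := by
  have h8 : ∑ i : Fin n, (lag x i ^ 4) ^ 2 ≤ (∑ i : Fin n, lag x i ^ 4) ^ 2 :=
    Finset.sum_sq_le_sq_sum_of_nonneg fun i _ => by positivity
  have hi : ∀ i : Fin n, score n x i ^ 4
      ≤ 8 / (n : ℝ) ^ 2 * (lag x i ^ 4 * z i ^ 4) + 8 * δ ^ 4 / (n : ℝ) ^ 2 * (lag x i ^ 4) ^ 2 := by
    intro i
    have h4 : √(n : ℝ) ^ 4 = (n : ℝ) ^ 2 := by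
      rw [show (4 : ℕ) = 2 * 2 by rfl, pow_mul, Real.sq_sqrt (by positivity)]
    rw [score_eq hx h0, ← hδ, div_pow, h4]
    have hab : ∀ a b : ℝ, (a - b) ^ 4 ≤ 8 * (a ^ 4 + b ^ 4) := fun a b => by
      have h1 : (a - b) ^ 2 ≤ 2 * (a ^ 2 + b ^ 2) := by nlinarith [sq_nonneg (a + b)]
      have h2 := pow_le_pow_left₀ (sq_nonneg _) h1 2
      nlinarith [sq_nonneg (a ^ 2 - b ^ 2)]
    calc _ ≤ 8 * ((lag x i * z i) ^ 4 + (δ * lag x i ^ 2) ^ 4) / (n : ℝ) ^ 2 := by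
          gcongr; exact hab _ _
      _ = _ := by ring
  calc _ ≤ ∑ i : Fin n, (8 / (n : ℝ) ^ 2 * (lag x i ^ 4 * z i ^ 4)
        + 8 * δ ^ 4 / (n : ℝ) ^ 2 * (lag x i ^ 4) ^ 2) := Finset.sum_le_sum fun i _ => hi i
    _ = 8 / (n : ℝ) ^ 2 * ∑ i : Fin n, lag x i ^ 4 * z i ^ 4
        + 8 * δ ^ 4 / (n : ℝ) ^ 2 * ∑ i : Fin n, (lag x i ^ 4) ^ 2 := by
        rw [Finset.sum_add_distrib, Finset.mul_sum, Finset.mul_sum]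
    _ ≤ 8 / (n : ℝ) ^ 2 * ∑ i : Fin n, lag x i ^ 4 * z i ^ 4
        + 8 * δ ^ 4 / (n : ℝ) ^ 2 * (∑ i : Fin n, lag x i ^ 4) ^ 2 := by gcongr
    _ = _ := by ring

/-- Small empirical errors imply the moment conditions on the scores and on the denominator. -/
theorem tendsto_moments_of_dataError {θ σ : ℝ} (hθ : |θ| < 1) (hσ : 0 < σ) {x z : ℕ → ℝ}
    (hx : ∀ i, x (i + 1) = θ * x i + z i) {ns : ℕ → ℕ} (hns : Tendsto ns atTop atTop)
    {s : ℕ → ℝ} (h : Tendsto (fun k => dataError (ns k) (s (ns k)) σ x z) atTop (𝓝 0)) :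
    Tendsto (fun k => (∑ i : Fin (ns k), lag x i ^ 2) / ns k) atTop (𝓝 (σ ^ 2 / (1 - θ ^ 2))) ∧
    Tendsto (fun k => s (ns k) ^ 2 * (∑ i : Fin (ns k), lag x i ^ 4) / (ns k : ℝ) ^ 2) atTop
      (𝓝 0) ∧
    Tendsto (fun k => ∑ i, score (ns k) x i ^ 2) atTop (𝓝 (σ ^ 2 * (σ ^ 2 / (1 - θ ^ 2)))) ∧
    Tendsto (fun k => ∑ i, score (ns k) x i ^ 4) atTop (𝓝 0) := by
  have hθ2 : 0 < 1 - θ ^ 2 := by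
    have := sq_lt_one_iff_abs_lt_one θ |>.2 hθ
    linarith
  have hpos : ∀ k,
      0 ≤ √(ns k : ℝ) * ((∑ i : Fin (ns k), lag x i * z i) / ns k) ^ 2 ∧
      0 ≤ ((∑ i : Fin (ns k), lag x i ^ 2 * (z i ^ 2 - σ ^ 2)) / ns k) ^ 2 ∧
      0 ≤ ((∑ i : Fin (ns k), if (i : ℕ) = 0 then 0 else z i ^ 2 - σ ^ 2) / ns k) ^ 2 ∧
      0 ≤ (√(ns k : ℝ))⁻¹ * ((∑ i : Fin (ns k), lag x i ^ 4) / ns k) ∧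
      0 ≤ s (ns k) ^ 2 * (∑ i : Fin (ns k), lag x i ^ 4) / (ns k : ℝ) ^ 2 ∧
      0 ≤ (∑ i : Fin (ns k), lag x i ^ 4 * z i ^ 4) / (ns k : ℝ) ^ 2 ∧
      0 ≤ (x 1 ^ 2 + x (ns k) ^ 2) / ns k := fun k =>
    ⟨by positivity, by positivity, by positivity, by positivity, by positivity, by positivity,
      by positivity⟩
  have sq : ∀ f : ℕ → ℝ, (∀ k, 0 ≤ f k) →
      (∀ k, f k ≤ dataError (ns k) (s (ns k)) σ x z) → Tendsto f atTop (𝓝 0) := fun f h0 h1 =>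
    squeeze_zero h0 h1 h
  have e1 := sq _ (fun k => (hpos k).1) fun k => by
    obtain ⟨h1, h2, h3, h4, h5, h6, h7⟩ := hpos k; rw [dataError]; linarith
  have e2 := sq _ (fun k => (hpos k).2.1) fun k => by
    obtain ⟨h1, h2, h3, h4, h5, h6, h7⟩ := hpos k; rw [dataError]; linarith
  have e3 := sq _ (fun k => (hpos k).2.2.1) fun k => by
    obtain ⟨h1, h2, h3, h4, h5, h6, h7⟩ := hpos k; rw [dataError]; linarith
  have e4 := sq _ (fun k => (hpos k).2.2.2.1) fun k => by
    obtain ⟨h1, h2, h3, h4, h5, h6, h7⟩ := hpos k; rw [dataError]; linarith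
  have e5 := sq _ (fun k => (hpos k).2.2.2.2.1) fun k => by
    obtain ⟨h1, h2, h3, h4, h5, h6, h7⟩ := hpos k; rw [dataError]; linarith
  have e6 := sq _ (fun k => (hpos k).2.2.2.2.2.1) fun k => by
    obtain ⟨h1, h2, h3, h4, h5, h6, h7⟩ := hpos k; rw [dataError]; linarith
  have e7 := sq _ (fun k => (hpos k).2.2.2.2.2.2) fun k => by
    obtain ⟨h1, h2, h3, h4, h5, h6, h7⟩ := hpos k; rw [dataError]; linarith
  have hn1 := hns.eventually_ge_atTop 1
  have a1 : Tendsto (fun k => (∑ i : Fin (ns k), lag x i * z i) / (ns k : ℝ)) atTop (𝓝 0) := by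
    refine tendsto_zero_of_sq (squeeze_zero' (Eventually.of_forall fun k => sq_nonneg _) ?_ e1)
    filter_upwards [hn1] with k hk
    refine le_mul_of_one_le_left (sq_nonneg _) ?_
    rw [Real.one_le_sqrt]
    exact_mod_cast hk
  have a2 := tendsto_zero_of_sq e2
  have a3 := tendsto_zero_of_sq e3
  have ninv : Tendsto (fun k => ((ns k : ℝ))⁻¹) atTop (𝓝 0) :=
    tendsto_inv_atTop_nhds_zero_nat.comp hns
  have hS2 : Tendsto (fun k => (∑ i : Fin (ns k), lag x i ^ 2) / (ns k : ℝ)) atTop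
      (𝓝 (σ ^ 2 / (1 - θ ^ 2))) := by
    have a7 : Tendsto (fun k => (x (ns k) ^ 2 - x 1 ^ 2) / (ns k : ℝ)) atTop (𝓝 0) := by
      refine squeeze_zero_norm (fun k => ?_) e7
      rw [Real.norm_eq_abs, abs_div, Nat.abs_cast]
      gcongr
      rw [abs_le]
      constructor <;> nlinarith [sq_nonneg (x 1), sq_nonneg (x (ns k))]
    have hl := ((((a1.const_mul (2 * θ)).add a3).add ((ninv.const_sub 1).const_mul (σ ^ 2))).sub
      a7).div_const (1 - θ ^ 2)
    simp only [mul_zero, add_zero, sub_zero, zero_add, mul_one] at hl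
    refine hl.congr' ?_
    filter_upwards [hn1] with k hk
    have hk0 : (ns k : ℝ) ≠ 0 := by positivity
    rw [div_eq_iff hθ2.ne', div_mul_eq_mul_div, mul_comm _ (1 - θ ^ 2),
      sum_lag_sq_eq (σ := σ) hx hk]
    field_simp
  have hγ : 0 < σ ^ 2 / (1 - θ ^ 2) := by positivity
  have hQ : Tendsto (fun k => (∑ i : Fin (ns k), (lag x i * z i) ^ 2) / (ns k : ℝ)) atTop
      (𝓝 (σ ^ 2 * (σ ^ 2 / (1 - θ ^ 2)))) := by
    have hl := a2.add (hS2.const_mul (σ ^ 2))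
    rw [zero_add] at hl
    refine hl.congr fun k => ?_
    rw [mul_div_assoc', ← add_div, Finset.mul_sum, ← Finset.sum_add_distrib]
    congr 1
    exact Finset.sum_congr rfl fun i _ => by ring
  set δ : ℕ → ℝ := fun k => (∑ i : Fin (ns k), lag x i * z i) / (∑ i : Fin (ns k), lag x i ^ 2)
    with hδ
  have hS0 : ∀ᶠ k in atTop, ∑ i : Fin (ns k), lag x i ^ 2 ≠ 0 := by
    filter_upwards [hS2.eventually_ne hγ.ne'] with k hk h0
    exact hk (by rw [h0, zero_div])
  have hr : Tendsto (fun k => δ k ^ 2 * ((∑ i : Fin (ns k), lag x i ^ 4) / (ns k : ℝ))) atTop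
      (𝓝 0) := by
    have hl := (e1.mul e4).div (hS2.pow 2) (by positivity)
    rw [zero_mul, zero_div] at hl
    refine hl.congr' ?_
    filter_upwards [hn1, hS0] with k hk h0
    have hk0 : (ns k : ℝ) ≠ 0 := by positivity
    have hk1 : √(ns k : ℝ) ≠ 0 := by positivity
    simp only [Pi.div_apply, hδ]
    field_simp
  refine ⟨hS2, e5, ?_, ?_⟩
  · have hdiff : Tendsto (fun k => ∑ i, score (ns k) x i ^ 2
        - (∑ i : Fin (ns k), (lag x i * z i) ^ 2) / (ns k : ℝ)) atTop (𝓝 0) := by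
      have hl := ((hQ.mul hr).sqrt.const_mul 2).add hr
      simp only [mul_zero, Real.sqrt_zero, add_zero] at hl
      refine squeeze_zero_norm' ?_ hl
      filter_upwards [hS0] with k h0
      exact sum_score_sq hx h0 rfl
    simpa using hdiff.add hQ
  · have hl := (e6.const_mul 8).add ((hr.pow 2).const_mul 8)
    simp only [mul_zero, zero_pow two_ne_zero, add_zero] at hl
    refine squeeze_zero' (Eventually.of_forall fun k => by positivity) ?_ hl
    filter_upwards [hS0] with k h0
    exact sum_score_pow_four_le hx h0 rfl

end Data

/-! ### The empirical errors of the AR(1) process vanish in mean -/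

section MeanErrors

variable {Ω : Type*} [MeasurableSpace Ω] {P : Measure Ω}

theorem integrable_pow_four {U : Ω → ℝ} (hU : MemLp U 4 P) : Integrable (fun ω => U ω ^ 4) P := by
  have h := MemLp.integrable_norm_pow (p := 4) (by exact_mod_cast hU) (by norm_num)
  refine h.congr (Eventually.of_forall fun ω => ?_)
  simp only [Real.norm_eq_abs]
  exact Even.pow_abs (by decide) _

theorem memLp_two_sq {U : Ω → ℝ} (hU : MemLp U 4 P) : MemLp (fun ω => U ω ^ 2) 2 P := by
  refine (memLp_two_iff_integrable_sq (f := fun ω => U ω ^ 2) (hU.1.pow 2)).2 ?_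
  simpa only [← pow_mul] using integrable_pow_four hU

variable {X Z : ℕ → Ω → ℝ} {θ σ : ℝ}

theorem sum_ite_le (n : ℕ) : ∑ i : Fin n, (if (i : ℕ) = 0 then (0 : ℝ) else 1) ≤ n := by
  calc _ ≤ ∑ _i : Fin n, (1 : ℝ) := Finset.sum_le_sum fun i _ => by split_ifs <;> norm_num
    _ = n := by simp

namespace IsStationaryAR1

variable (hX : IsStationaryAR1 P X Z θ σ)
include hX

theorem integral_innovation_sq : ∫ ω, Z 1 ω ^ 2 ∂P = σ ^ 2 := by
  rw [← hX.variance_eq, variance_of_integral_eq_zero (hX.measurable_Z 1).aemeasurable hX.mean_zero]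

variable [IsProbabilityMeasure P]

theorem integrable_mean_innovation_sq {G H : ℝ → ℝ} (hG : Measurable G) (hH : Measurable H)
    (hG2 : MemLp (fun ω => G (X 0 ω)) 2 P) (hH2 : MemLp (fun ω => H (Z 1 ω)) 2 P) (n : ℕ) :
    Integrable (fun ω => ((∑ i : Fin n, (if (i : ℕ) = 0 then (0 : ℝ) else 1) *
      (G (X i ω) * H (Z (i + 1) ω))) / n) ^ 2) P := by
  have h : MemLp (fun ω => (∑ i : Fin n, (if (i : ℕ) = 0 then (0 : ℝ) else 1) *
      (G (X i ω) * H (Z (i + 1) ω))) / n) 2 P := by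
    simp_rw [div_eq_mul_inv]
    exact (memLp_finsetSum Finset.univ fun (i : Fin n) _ =>
      (hX.memLp_mul_innovation hG hH hG2 hH2 (i : ℕ)).1.const_mul
        (if (i : ℕ) = 0 then (0 : ℝ) else 1)).mul_const _
  exact h.integrable_sq

theorem integral_mean_innovation_sq_le {G H : ℝ → ℝ} (hG : Measurable G) (hH : Measurable H)
    (hG2 : MemLp (fun ω => G (X 0 ω)) 2 P) (hH2 : MemLp (fun ω => H (Z 1 ω)) 2 P)
    (hH0 : ∫ ω, H (Z 1 ω) ∂P = 0) (n : ℕ) :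
    ∫ ω, ((∑ i : Fin n, (if (i : ℕ) = 0 then (0 : ℝ) else 1) *
      (G (X i ω) * H (Z (i + 1) ω))) / n) ^ 2 ∂P
      ≤ ((∫ ω, G (X 0 ω) ^ 2 ∂P) * ∫ ω, H (Z 1 ω) ^ 2 ∂P) * (n : ℝ)⁻¹ := by
  have h0 : 0 ≤ (∫ ω, G (X 0 ω) ^ 2 ∂P) * ∫ ω, H (Z 1 ω) ^ 2 ∂P :=
    mul_nonneg (integral_nonneg fun _ => sq_nonneg _) (integral_nonneg fun _ => sq_nonneg _)
  simp_rw [div_pow]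
  rw [integral_div, hX.integral_sum_mul_innovation_sq hG hH hG2 hH2 hH0]
  rcases Nat.eq_zero_or_pos n with rfl | hn
  · simp
  · have hn0 : (n : ℝ) ≠ 0 := by positivity
    have hnn : (n : ℝ)⁻¹ * (n : ℝ) ^ 2 = n := by field_simp
    rw [div_le_iff₀ (by positivity), mul_assoc _ (n : ℝ)⁻¹, hnn]
    gcongr
    refine le_trans (le_of_eq (Finset.sum_congr rfl fun i _ => ?_)) (sum_ite_le n)
    split_ifs <;> norm_num

theorem integral_sum_pow_four (n : ℕ) :
    Integrable (fun ω => ∑ i : Fin n, lag (fun t => X t ω) i ^ 4) P ∧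
    ∫ ω, ∑ i : Fin n, lag (fun t => X t ω) i ^ 4 ∂P ≤ n * ∫ ω, X 0 ω ^ 4 ∂P := by
  have hi : ∀ t, Integrable (fun ω => X t ω ^ 4) P := fun t =>
    integrable_pow_four ((hX.identDistrib_X t).memLp_iff.2 hX.memLp_X_zero)
  have he : ∀ ω, ∑ i : Fin n, lag (fun t => X t ω) i ^ 4
      = ∑ i : Fin n, (if (i : ℕ) = 0 then (0 : ℝ) else 1) * X i ω ^ 4 := fun ω =>
    Finset.sum_congr rfl fun i _ => by unfold lag; split_ifs <;> simp
  have hm : ∀ t, ∫ ω, X t ω ^ 4 ∂P = ∫ ω, X 0 ω ^ 4 ∂P := fun t =>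
    ((hX.identDistrib_X t).comp (u := fun x => x ^ 4) (by fun_prop)).integral_eq
  simp_rw [he]
  have hint : ∀ i ∈ (Finset.univ : Finset (Fin n)), Integrable (fun ω =>
      (if (i : ℕ) = 0 then (0 : ℝ) else 1) * X i ω ^ 4) P := fun i _ => (hi i).const_mul _
  refine ⟨integrable_finsetSum _ hint, ?_⟩
  rw [integral_finsetSum _ hint]
  simp_rw [integral_const_mul, hm, ← Finset.sum_mul]
  have : 0 ≤ ∫ ω, X 0 ω ^ 4 ∂P := integral_nonneg fun _ => by positivity
  gcongr
  exact sum_ite_le n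

theorem integral_sum_mul_pow_four (n : ℕ) :
    Integrable (fun ω => ∑ i : Fin n, lag (fun t => X t ω) i ^ 4 * Z (i + 1) ω ^ 4) P ∧
    ∫ ω, ∑ i : Fin n, lag (fun t => X t ω) i ^ 4 * Z (i + 1) ω ^ 4 ∂P
      ≤ n * ((∫ ω, (X 0 ω ^ 2) ^ 2 ∂P) * ∫ ω, (Z 1 ω ^ 2) ^ 2 ∂P) := by
  have h := hX.memLp_mul_innovation (G := fun x => x ^ 2) (H := fun x => x ^ 2) (by fun_prop)
    (by fun_prop) (memLp_two_sq hX.memLp_X_zero) (memLp_two_sq hX.fourth_moment)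
  have he : ∀ ω, ∑ i : Fin n, lag (fun t => X t ω) i ^ 4 * Z (i + 1) ω ^ 4
      = ∑ i : Fin n, (if (i : ℕ) = 0 then (0 : ℝ) else 1) *
        (X i ω ^ 2 * Z (i + 1) ω ^ 2) ^ 2 := fun ω =>
    Finset.sum_congr rfl fun i _ => by unfold lag; split_ifs <;> ring
  have hi : ∀ t, Integrable (fun ω => (X t ω ^ 2 * Z (t + 1) ω ^ 2) ^ 2) P :=
    fun t => (h t).1.integrable_sq
  simp_rw [he]
  have hint : ∀ i ∈ (Finset.univ : Finset (Fin n)), Integrable (fun ω =>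
      (if (i : ℕ) = 0 then (0 : ℝ) else 1) * (X i ω ^ 2 * Z (i + 1) ω ^ 2) ^ 2) P :=
    fun i _ => (hi i).const_mul _
  refine ⟨integrable_finsetSum _ hint, ?_⟩
  rw [integral_finsetSum _ hint]
  simp_rw [integral_const_mul, (h _).2, ← Finset.sum_mul]
  have : 0 ≤ (∫ ω, (X 0 ω ^ 2) ^ 2 ∂P) * ∫ ω, (Z 1 ω ^ 2) ^ 2 ∂P :=
    mul_nonneg (integral_nonneg fun _ => sq_nonneg _) (integral_nonneg fun _ => sq_nonneg _)
  gcongr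
  exact sum_ite_le n

/-- The empirical errors of the process are integrable and vanish in mean: each summand is either the
second moment of a normalized sum of uncorrelated variables or a mean of bounded moments. -/
theorem tendsto_integral_dataError {s : ℕ → ℝ}
    (hs : (fun n => s n ^ 2) =o[atTop] fun n : ℕ => (n : ℝ)) :
    (∀ n, Integrable (fun ω => dataError n (s n) σ (fun t => X t ω) fun i => Z (i + 1) ω) P) ∧
    Tendsto (fun n => ∫ ω, dataError n (s n) σ (fun t => X t ω) (fun i => Z (i + 1) ω) ∂P) atTop
      (𝓝 0) := by
  have hadd : ∀ {f g : ℕ → Ω → ℝ},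
      ((∀ n, Integrable (f n) P) ∧ Tendsto (fun n => ∫ ω, f n ω ∂P) atTop (𝓝 0)) →
      ((∀ n, Integrable (g n) P) ∧ Tendsto (fun n => ∫ ω, g n ω ∂P) atTop (𝓝 0)) →
      ((∀ n, Integrable (fun ω => f n ω + g n ω) P) ∧
        Tendsto (fun n => ∫ ω, (f n ω + g n ω) ∂P) atTop (𝓝 0)) := by
    intro f g hf hg
    refine ⟨fun n => (hf.1 n).add (hg.1 n), ?_⟩
    have := hf.2.add hg.2
    rw [add_zero] at this
    exact this.congr fun n => (integral_add (hf.1 n) (hg.1 n)).symm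
  have hX4 := hX.memLp_X_zero
  have hX2 : MemLp (X 0) 2 P := hX4.mono_exponent (by norm_num)
  have hZ2 : MemLp (Z 1) 2 P := hX.fourth_moment.mono_exponent (by norm_num)
  have hH2 : MemLp (fun ω => Z 1 ω ^ 2 - σ ^ 2) 2 P :=
    (memLp_two_sq hX.fourth_moment).sub (memLp_const _)
  have hH0 : ∫ ω, (Z 1 ω ^ 2 - σ ^ 2) ∂P = 0 := by
    rw [integral_sub hZ2.integrable_sq (integrable_const _), hX.integral_innovation_sq]
    simp
  have hinv : Tendsto (fun n : ℕ => (n : ℝ)⁻¹) atTop (𝓝 0) := tendsto_inv_atTop_nhds_zero_nat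
  have hsqrt : Tendsto (fun n : ℕ => (√(n : ℝ))⁻¹) atTop (𝓝 0) := by
    have := hinv.sqrt
    simpa using this
  have hlag1 : ∀ n ω, ∑ i : Fin n, lag (fun t => X t ω) i * Z (i + 1) ω
      = ∑ i : Fin n, (if (i : ℕ) = 0 then (0 : ℝ) else 1) * (X i ω * Z (i + 1) ω) := fun n ω =>
    Finset.sum_congr rfl fun i _ => by unfold lag; split_ifs <;> ring
  have hlag2 : ∀ n ω, ∑ i : Fin n, lag (fun t => X t ω) i ^ 2 * (Z (i + 1) ω ^ 2 - σ ^ 2)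
      = ∑ i : Fin n, (if (i : ℕ) = 0 then (0 : ℝ) else 1) *
        (X i ω ^ 2 * (Z (i + 1) ω ^ 2 - σ ^ 2)) := fun n ω =>
    Finset.sum_congr rfl fun i _ => by unfold lag; split_ifs <;> ring
  have hlag3 : ∀ n ω, (∑ i : Fin n, if (i : ℕ) = 0 then 0 else Z (i + 1) ω ^ 2 - σ ^ 2)
      = ∑ i : Fin n, (if (i : ℕ) = 0 then (0 : ℝ) else 1) *
        (1 * (Z (i + 1) ω ^ 2 - σ ^ 2)) := fun n ω =>
    Finset.sum_congr rfl fun i _ => by split_ifs <;> ring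
  have hn2 : ∀ n : ℕ, (n : ℝ) / (n : ℝ) ^ 2 = (n : ℝ)⁻¹ := fun n => by
    rcases Nat.eq_zero_or_pos n with rfl | hn
    · simp
    · field_simp
  unfold dataError
  refine hadd (hadd (hadd (hadd (hadd (hadd ?_ ?_) ?_) ?_) ?_) ?_) ?_
  · simp_rw [hlag1]
    refine ⟨fun n => (hX.integrable_mean_innovation_sq measurable_id measurable_id hX2 hZ2
      n).const_mul _, ?_⟩
    have hl := hsqrt.const_mul ((∫ ω, X 0 ω ^ 2 ∂P) * ∫ ω, Z 1 ω ^ 2 ∂P)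
    rw [mul_zero] at hl
    refine squeeze_zero (fun n => integral_nonneg fun ω => by positivity) (fun n => ?_) hl
    rw [integral_const_mul]
    calc _ ≤ √(n : ℝ) * (((∫ ω, X 0 ω ^ 2 ∂P) * ∫ ω, Z 1 ω ^ 2 ∂P) * (n : ℝ)⁻¹) := by
          gcongr
          exact hX.integral_mean_innovation_sq_le measurable_id measurable_id hX2 hZ2
            hX.mean_zero n
      _ = ((∫ ω, X 0 ω ^ 2 ∂P) * ∫ ω, Z 1 ω ^ 2 ∂P) * (√(n : ℝ) / n) := by ring
      _ = _ := by rw [Real.sqrt_div_self', one_div]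
  · simp_rw [hlag2]
    refine ⟨hX.integrable_mean_innovation_sq (G := fun x => x ^ 2) (H := fun x => x ^ 2 - σ ^ 2)
      (by fun_prop) (by fun_prop) (memLp_two_sq hX4) hH2, ?_⟩
    have hl := hinv.const_mul ((∫ ω, (X 0 ω ^ 2) ^ 2 ∂P) * ∫ ω, (Z 1 ω ^ 2 - σ ^ 2) ^ 2 ∂P)
    rw [mul_zero] at hl
    exact squeeze_zero (fun n => integral_nonneg fun ω => by positivity)
      (hX.integral_mean_innovation_sq_le (G := fun x => x ^ 2) (H := fun x => x ^ 2 - σ ^ 2)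
      (by fun_prop) (by fun_prop) (memLp_two_sq hX4) hH2 hH0) hl
  · simp_rw [hlag3]
    refine ⟨hX.integrable_mean_innovation_sq (G := fun _ => 1) (H := fun x => x ^ 2 - σ ^ 2)
      (by fun_prop) (by fun_prop) (memLp_const 1) hH2, ?_⟩
    have hl := hinv.const_mul ((∫ _, (1 : ℝ) ^ 2 ∂P) * ∫ ω, (Z 1 ω ^ 2 - σ ^ 2) ^ 2 ∂P)
    rw [mul_zero] at hl
    exact squeeze_zero (fun n => integral_nonneg fun ω => by positivity)
      (hX.integral_mean_innovation_sq_le (G := fun _ => 1) (H := fun x => x ^ 2 - σ ^ 2)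
      (by fun_prop) (by fun_prop) (memLp_const 1) hH2 hH0) hl
  · refine ⟨fun n => ((hX.integral_sum_pow_four n).1.div_const _).const_mul _, ?_⟩
    have hl := hsqrt.mul_const (∫ ω, X 0 ω ^ 4 ∂P)
    rw [zero_mul] at hl
    refine squeeze_zero' (Eventually.of_forall fun n => integral_nonneg fun ω => by positivity) ?_ hl
    filter_upwards [eventually_ge_atTop 1] with n hn
    have hn0 : (n : ℝ) ≠ 0 := by positivity
    rw [integral_const_mul, integral_div]
    gcongr
    rw [div_le_iff₀ (by positivity), mul_comm]
    exact (hX.integral_sum_pow_four n).2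
  · refine ⟨fun n => ((hX.integral_sum_pow_four n).1.const_mul _).div_const _, ?_⟩
    have hl := hs.tendsto_div_nhds_zero.mul_const (∫ ω, X 0 ω ^ 4 ∂P)
    rw [zero_mul] at hl
    refine squeeze_zero (fun n => integral_nonneg fun ω => by positivity) (fun n => ?_) hl
    rw [integral_div, integral_const_mul]
    calc _ ≤ s n ^ 2 * (n * ∫ ω, X 0 ω ^ 4 ∂P) / (n : ℝ) ^ 2 := by
          gcongr; exact (hX.integral_sum_pow_four n).2
      _ = s n ^ 2 * ((n : ℝ) / (n : ℝ) ^ 2) * ∫ ω, X 0 ω ^ 4 ∂P := by ring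
      _ = _ := by rw [hn2, ← div_eq_mul_inv]
  · refine ⟨fun n => (hX.integral_sum_mul_pow_four n).1.div_const _, ?_⟩
    have hl := hinv.mul_const ((∫ ω, (X 0 ω ^ 2) ^ 2 ∂P) * ∫ ω, (Z 1 ω ^ 2) ^ 2 ∂P)
    rw [zero_mul] at hl
    refine squeeze_zero (fun n => integral_nonneg fun ω => by positivity) (fun n => ?_) hl
    rw [integral_div, ← hn2, div_mul_eq_mul_div]
    gcongr
    exact (hX.integral_sum_mul_pow_four n).2
  · have hi : ∀ t, Integrable (fun ω => X t ω ^ 2) P := fun t =>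
      ((hX.identDistrib_X t).memLp_iff.2 hX2).integrable_sq
    have hm : ∀ t, ∫ ω, X t ω ^ 2 ∂P = ∫ ω, X 0 ω ^ 2 ∂P := fun t =>
      ((hX.identDistrib_X t).comp (u := fun x => x ^ 2) (by fun_prop)).integral_eq
    refine ⟨fun n => ((hi 1).add (hi n)).div_const _, ?_⟩
    have hl := hinv.const_mul (∫ ω, X 0 ω ^ 2 ∂P + ∫ ω, X 0 ω ^ 2 ∂P)
    rw [mul_zero] at hl
    refine hl.congr fun n => ?_
    rw [integral_div, integral_add (hi 1) (hi n), hm 1, hm n, div_eq_mul_inv]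

theorem tendstoInMeasure_dataError {s : ℕ → ℝ}
    (hs : (fun n => s n ^ 2) =o[atTop] fun n : ℕ => (n : ℝ)) :
    TendstoInMeasure P (fun n ω => dataError n (s n) σ (fun t => X t ω) fun i => Z (i + 1) ω) atTop
      fun _ => 0 := by
  obtain ⟨hi, ht⟩ := hX.tendsto_integral_dataError hs
  refine tendstoInMeasure_of_tendsto_eLpNorm one_ne_zero (fun n => (hi n).1)
    aestronglyMeasurable_const ?_
  have he : ∀ n, eLpNorm ((fun ω => dataError n (s n) σ (fun t => X t ω) fun i => Z (i + 1) ω)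
      - fun _ => 0) 1 P
      = ENNReal.ofReal (∫ ω, dataError n (s n) σ (fun t => X t ω) (fun i => Z (i + 1) ω) ∂P) := by
    intro n
    have h0 : ∀ ω, 0 ≤ dataError n (s n) σ (fun t => X t ω) (fun i => Z (i + 1) ω) := fun ω => by
      unfold dataError; positivity
    rw [eLpNorm_one_eq_lintegral_enorm, ofReal_integral_eq_lintegral_ofReal (hi n)
      (Eventually.of_forall h0)]
    refine lintegral_congr fun ω => ?_
    simp [Real.enorm_eq_ofReal_abs, abs_of_nonneg (h0 ω)]
  simp_rw [he]
  simpa using ENNReal.tendsto_ofReal ht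

end IsStationaryAR1

end MeanErrors

/-! ### The conditional distribution given the data -/

section Conditional

variable {Ω : Type*} {X : ℕ → Ω → ℝ}

/-- The data `X 1, …, X n`, extended by zero to a sequence. -/
noncomputable def dataSeq (X : ℕ → Ω → ℝ) (n : ℕ) (ω : Ω) (t : ℕ) : ℝ :=
  if t ∈ Finset.Icc 1 n then X t ω else 0

theorem dataSigma_eq_comap (X : ℕ → Ω → ℝ) (n : ℕ) :
    dataSigma X n = MeasurableSpace.comap (dataSeq X n) inferInstance := by
  apply le_antisymm
  · refine iSup₂_le fun t ht => ?_
    have : X t = (fun x : ℕ → ℝ => x t) ∘ dataSeq X n := by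
      funext ω; simp [dataSeq, Finset.mem_Icc.1 ht]
    rw [this, ← MeasurableSpace.comap_comp]
    exact MeasurableSpace.comap_mono (measurable_pi_apply t).comap_le
  · rw [← measurable_iff_comap_le]
    refine @measurable_pi_lambda _ _ _ (dataSigma X n) _ _ fun t => ?_
    by_cases ht : t ∈ Finset.Icc 1 n
    · simp only [dataSeq, ht, if_true]
      exact Measurable.of_comap_le (le_iSup₂_of_le t ht le_rfl)
    · simp only [dataSeq, ht, if_false]
      exact @measurable_const _ _ _ (dataSigma X n) _

theorem bootStat_congr {n : ℕ} {x x' : ℕ → ℝ} (h : ∀ t ∈ Finset.Icc 1 n, x t = x' t) (s : ℝ)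
    (u : Fin n → ℝ) : bootStat n s x u = bootStat n s x' u := by
  have h1 : ∀ i : Fin n, x (i + 1) = x' (i + 1) := fun i =>
    h _ (Finset.mem_Icc.2 ⟨by omega, by omega⟩)
  have h2 : ∀ i : Fin n, lag x i = lag x' i := fun i => by
    unfold lag
    split_ifs with h0
    · rfl
    · exact h _ (Finset.mem_Icc.2 ⟨by omega, by omega⟩)
  simp only [bootStat, lseData, h1, h2]

@[fun_prop]
theorem measurable_lag (i : ℕ) : Measurable fun x : ℕ → ℝ => lag x i := by
  unfold lag; split_ifs <;> fun_prop

theorem measurable_bootStat (n : ℕ) (s : ℝ) :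
    Measurable fun p : (ℕ → ℝ) × (Fin n → ℝ) => bootStat n s p.1 p.2 := by
  have hl : ∀ i, Measurable fun p : (ℕ → ℝ) × (Fin n → ℝ) => lag p.1 i := fun i =>
    (measurable_lag i).comp measurable_fst
  unfold bootStat lseData
  fun_prop

variable [MeasurableSpace Ω] {P : Measure Ω} [IsProbabilityMeasure P] {w : ℕ → ℕ → Ω → ℝ}

/-- The conditional distribution of the bootstrap error given the data is obtained by freezing the
data. -/
theorem IsBootstrapWeights.condProb_ae_eq (hw : IsBootstrapWeights P X w)
    (hX : ∀ t, Measurable (X t)) (n : ℕ) (s y : ℝ) :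
    P⟦{ω' | √(n : ℝ) * s⁻¹ * (bootLse X w n ω' - lse X n ω') ≤ y} | dataSigma X n⟧
      =ᵐ[P] fun ω => P.real {ω' | bootStat n s (fun t => X t ω) (row w n ω') ≤ y} := by
  have hξ : Measurable (dataSeq X n) := by
    refine measurable_pi_lambda _ fun t => ?_
    unfold dataSeq
    split_ifs
    · exact hX t
    · exact measurable_const
  have hrow : Measurable (row w n) := measurable_pi_lambda _ fun i => hw.measurable_row n i
  have hind : IndepFun (dataSeq X n) (row w n) P := by
    have hφ : Measurable fun (x : ℕ → ℝ) (t : ℕ) => if t ∈ Finset.Icc 1 n then x t else 0 := by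
      refine measurable_pi_lambda _ fun t => ?_
      split_ifs
      · exact measurable_pi_apply t
      · exact measurable_const
    exact ((hw.indep_data n).comp measurable_id hφ).symm
  have hstat : ∀ ω ω', bootStat n s (fun t => X t ω) (row w n ω')
      = bootStat n s (dataSeq X n ω) (row w n ω') := fun ω ω' =>
    bootStat_congr (fun t ht => by simp only [dataSeq, ht, if_true]) _ _
  have hA : MeasurableSet {p : (ℕ → ℝ) × (Fin n → ℝ) | bootStat n s p.1 p.2 ≤ y} :=
    measurableSet_le (measurable_bootStat n s) measurable_const
  set f : (ℕ → ℝ) × (Fin n → ℝ) → ℝ :=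
    {p | bootStat n s p.1 p.2 ≤ y}.indicator fun _ => 1 with hf
  have hfm : StronglyMeasurable f := stronglyMeasurable_const.indicator hA
  have hind1 : {ω' | √(n : ℝ) * s⁻¹ * (bootLse X w n ω' - lse X n ω') ≤ y}.indicator
      (fun _ => (1 : ℝ)) = fun ω => f (dataSeq X n ω, row w n ω) := by
    funext ω
    simp only [hf, Set.indicator, Set.mem_ofPred_eq, bootStat_eq, hstat]
  have hint : Integrable (fun ω => f (dataSeq X n ω, row w n ω)) P := by
    rw [← hind1]
    refine (integrable_const (1 : ℝ)).indicator ?_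
    simp only [bootStat_eq, hstat]
    exact (hξ.prodMk hrow) hA
  have hcd : condDistrib (row w n) (dataSeq X n) P
      =ᵐ[P.map (dataSeq X n)] Kernel.const _ (P.map (row w n)) := by
    have := Measure.isProbabilityMeasure_map hrow.aemeasurable (μ := P)
    rw [condDistrib_ae_eq_iff_measure_eq_compProd _ hrow.aemeasurable, Measure.compProd_const]
    exact (indepFun_iff_map_prod_eq_prod_map_map hξ.aemeasurable hrow.aemeasurable).1 hind
  rw [dataSigma_eq_comap, hind1]
  filter_upwards [condExp_prod_ae_eq_integral_condDistrib hξ hrow.aemeasurable hfm hint,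
    ae_of_ae_map hξ.aemeasurable hcd] with ω h1 h2
  rw [h1, h2, Kernel.const_apply]
  have hB : MeasurableSet {u : Fin n → ℝ | bootStat n s (dataSeq X n ω) u ≤ y} :=
    measurable_prodMk_left hA
  have hfu : (fun u => f (dataSeq X n ω, u))
      = {u : Fin n → ℝ | bootStat n s (dataSeq X n ω) u ≤ y}.indicator fun _ => 1 := by
    funext u; simp only [hf, Set.indicator, Set.mem_ofPred_eq]
  rw [hfu, integral_indicator_const _ hB, smul_eq_mul, mul_one, map_measureReal_apply hrow hB]
  simp only [hstat]
  rfl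

end Conditional

end WeightedBootstrap

/-- For every real `x`, the conditional probability given `X 1, …, X n` that
`√n σ_n⁻¹ (θ*_n - θ̂_n) ≤ x` minus `P(Y ≤ x)`, with `Y ~ N(0, 1 - θ²)`, tends to `0` in
probability. -/
theorem theorem1 {Ω : Type*} [MeasurableSpace Ω] (P : Measure Ω) [IsProbabilityMeasure P]
    (X Z : ℕ → Ω → ℝ) (θ σ : ℝ) (w : ℕ → ℕ → Ω → ℝ)
    (hX : WeightedBootstrap.IsStationaryAR1 P X Z θ σ)
    (hw : WeightedBootstrap.IsBootstrapWeights P X w) (x : ℝ) :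
    TendstoInMeasure P
      (fun (n : ℕ) ω =>
        (P⟦{ω' | √(n : ℝ) * (WeightedBootstrap.weightSd P w n)⁻¹ *
              (WeightedBootstrap.bootLse X w n ω' - WeightedBootstrap.lse X n ω') ≤ x} |
            WeightedBootstrap.dataSigma X n⟧) ω
          - (gaussianReal 0 (1 - θ ^ 2).toNNReal).real (Set.Iic x))
      atTop (fun _ => 0) := by
  have hθ2 : 0 < 1 - θ ^ 2 := by
    have := sq_lt_one_iff_abs_lt_one θ |>.2 hX.abs_theta_lt_one
    linarith
  have hσ := hX.sigma_pos
  have hγ : 0 < σ ^ 2 / (1 - θ ^ 2) := by positivity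
  have hvar : σ ^ 2 * (σ ^ 2 / (1 - θ ^ 2)) / (σ ^ 2 / (1 - θ ^ 2)) ^ 2 = 1 - θ ^ 2 := by
    field_simp
  have hcond := ae_all_iff.2 fun n =>
    hw.condProb_ae_eq hX.measurable_X n (WeightedBootstrap.weightSd P w n) x
  have hmeas : ∀ n : ℕ, AEStronglyMeasurable (fun ω =>
      (P⟦{ω' | √(n : ℝ) * (WeightedBootstrap.weightSd P w n)⁻¹ *
              (WeightedBootstrap.bootLse X w n ω' - WeightedBootstrap.lse X n ω') ≤ x} |
            WeightedBootstrap.dataSigma X n⟧) ω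
          - (gaussianReal 0 (1 - θ ^ 2).toNNReal).real (Set.Iic x)) P := fun n =>
    integrable_condExp.aestronglyMeasurable.sub aestronglyMeasurable_const
  refine (exists_seq_tendstoInMeasure_atTop_iff hmeas).2 fun ns hns => ?_
  have hsub := (hX.tendstoInMeasure_dataError hw.variance_upper).comp hns.tendsto_atTop
  obtain ⟨ns', hns', hconv⟩ := hsub.exists_seq_tendsto_ae
  refine ⟨ns', hns', ?_⟩
  have hns2 : Tendsto (fun k => ns (ns' k)) atTop atTop :=
    hns.tendsto_atTop.comp hns'.tendsto_atTop
  filter_upwards [hconv, hcond, hX.ae_recursion] with ω h1 h2 h3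
  obtain ⟨c1, c2, c3, c4⟩ := WeightedBootstrap.tendsto_moments_of_dataError
    (x := fun t => X t ω) (z := fun i => Z (i + 1) ω)
    hX.abs_theta_lt_one hσ h3 hns2 (s := WeightedBootstrap.weightSd P w) h1
  have hlim := hw.tendsto_bootStat_law hns2 hγ (mul_pos (pow_pos hσ 2) hγ) c1 c2 c3 c4 x
  rw [hvar] at hlim
  have hdiff := hlim.sub_const ((gaussianReal 0 (1 - θ ^ 2).toNNReal).real (Set.Iic x))
  rw [sub_self] at hdiff
  refine hdiff.congr fun k => ?_
  exact congrArg (· - (gaussianReal 0 (1 - θ ^ 2).toNNReal).real (Set.Iic x))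
    (h2 (ns (ns' k))).symm
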